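/- Let $0<r\le p$, let $f:\mathbb R^{p\times p}\to\mathbb R$ be twice continuously differentiable with $f(Z)=f(Z^\top)$ for all $Z$, and let $g:\mathbb R^{p\times r}\to\mathbb R$, $g(Y)=f(YY^\top)$. All matrix spaces carry the inner product $\langle A,B\rangle=\operatorname{trace}(A^\top B)$, and the manifold $\mathcal M_{r+}$ of $p\times p$ symmetric positive semidefinite matrices of rank $r$ is a Riemannian submanifold of $\mathbb R^{p\times p}$ with the induced metric. Write $\nabla g(Y)$ and $\nabla^2 g(Y)$ for the Euclidean gradient and Hessian, $\operatorname{grad} f(X)$ and $\operatorname{Hess} f(X):T_X\mathcal M_{r+}\to T_X\mathcal M_{r+}$ for the Riemannian gradient and Hessian of $f|_{\mathcal M_{r+}}$, with $\nabla^2 g(Y)[A,B]=\langle\nabla^2 g(Y)[A],B\rangle$ and $\operatorname{Hess} f(X)[\xi,\eta]=\langle\operatorname{Hess} f(X)[\xi],\eta\rangle$. Let $M^\dagger$ be the Moore–Penrose inverse and $\sigma_i$ the $i$-th largest singular value. Let $Y\in\mathbb R^{p\times r}$ have rank $r$ and let $X=YY^\top$. Then $$\operatorname{grad} f(X)=\tfrac12\Big(\nabla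 g(Y)Y^\dagger+(\nabla g(Y)Y^\dagger)^\top(I_p-YY^\dagger)\Big),\qquad \nabla g(Y)=2\operatorname{grad} f(X)\,Y.$$ Suppose in addition that $\nabla g(Y)=0$. Let $X=U\Sigma U^\top$ be any eigendecomposition, where $U\in\mathbb R^{p\times r}$ has orthonormal columns and $\Sigma\in\mathbb R^{r\times r}$ is diagonal with non-increasing diagonal. Let $U_\perp\in\mathbb R^{p\times(p-r)}$ be an orthonormal complement of $U$, and let $P=U^\top Y$. For $A\in\mathbb R^{p\times r}$ put $$\xi_Y^A=[U\ \ U_\perp]\begin{bmatrix}PA^\top U+U^\top AP^\top & PA^\top U_\perp\\ U_\perp^\top AP^\top & 0\end{bmatrix}[U\ \ U_\perp]^\top,$$ and let $$\mathscr A_{\rm null}=\{USP^{-\top}: S+S^\top=0\},\qquad \mathscr A_{\overline{\rm null}}=\{(US+U_\perp D)P^{-\top}: S\Sigma^{-1}\text{ symmetric},\ D\in\mathbb R^{(p-r)\times r}\}.$$ Then: 1. For every $A\in\mathbb R^{p\times r}$, $\xi_Y^A\in T_X\mathcal M_{r+}$ and $\nabla^2 g(Y)[A,A]=\operatorname{Hess}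 f(X)[\xi_Y^A,\xi_Y^A]$. 2. The map $\mathcal L_Y:A\mapsto\xi_Y^A$ is a linear bijection from $\mathscr A_{\overline{\rm null}}$ onto $T_X\mathcal M_{r+}$. For every $\xi\in T_X\mathcal M_{r+}$, $\operatorname{Hess} f(X)[\xi,\xi]=\nabla^2 g(Y)[\mathcal L_Y^{-1}(\xi),\mathcal L_Y^{-1}(\xi)]$, and for every $A\in\mathscr A_{\overline{\rm null}}$, $\nabla^2 g(Y)[A,A]=\operatorname{Hess} f(X)[\mathcal L_Y(A),\mathcal L_Y(A)]$. 3. $\dim\mathscr A_{\rm null}=(r^2-r)/2$, and $\nabla^2 g(Y)[A]=0$ for every $A\in\mathscr A_{\rm null}$. 4. Let $N=pr-(r^2-r)/2$. The gradient field $Z\mapsto\operatorname{grad} f(Z)$ is differentiable along $\mathcal M_{r+}$ at $X$, and $\operatorname{Hess} f(X)$ is symmetric and has $N=\dim T_X\mathcal M_{r+}$ real eigenvalues $\lambda_1\ge\dots\ge\lambda_N$. The Hessian $\nabla^2 g(Y)$ is symmetric and has $pr$ real eigenvalues (all counted with multiplicity); $(r^2-r)/2$ of these are zero, and the remaining ones,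 $\bar\lambda_1\ge\dots\ge\bar\lambda_N$, satisfy, for $i=1,\dots,N$, $$\min\{2\sigma_r(X)\lambda_i,\,4\sigma_1(X)\lambda_i\}\le\bar\lambda_i\le\max\{2\sigma_r(X)\lambda_i,\,4\sigma_1(X)\lambda_i\}.$$ -/

import Mathlib

open scoped Matrix Topology ContDiff

/-! ### Matrices as a Euclidean space: Frobenius norm and trace inner product -/

attribute [local instance] Matrix.frobeniusNormedAddCommGroup
  Matrix.frobeniusNormedSpace

/-- The Euclidean inner product `⟨A, B⟩ = trace (Aᵀ B)` on real matrices; its norm is the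
Frobenius norm. -/
noncomputable instance frobeniusInnerProductSpace {m n : Type*} [Fintype m] [Fintype n] :
    InnerProductSpace ℝ (Matrix m n ℝ) where
  inner A B := Matrix.trace (Aᵀ * B)
  norm_sq_eq_re_inner A := by
    have h : ‖A‖ ^ 2 = ∑ i, ∑ j, A i j ^ 2 := by
      rw [Matrix.frobenius_norm_def, ← Real.sqrt_eq_rpow, Real.sq_sqrt]
      · simp
      · positivity
    rw [h, Finset.sum_comm]
    simp [Matrix.trace, Matrix.mul_apply, sq]
  conj_inner_symm A B := by
    simp only [conj_trivial]
    rw [← Matrix.trace_transpose, Matrix.transpose_mul, Matrix.transpose_transpose]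
  add_left A B C := by simp [Matrix.add_mul]
  smul_left A B c := by simp

/-! ### The Moore-Penrose inverse -/

/-- The four Penrose equations: `B` is the Moore-Penrose inverse of the real matrix `A`. -/
structure IsMoorePenroseInverse {m n : Type*} [Fintype m] [Fintype n]
    (A : Matrix m n ℝ) (B : Matrix n m ℝ) : Prop where
  mul_mul_left : A * B * A = A
  mul_mul_right : B * A * B = B
  symm_left : (A * B)ᵀ = A * B
  symm_right : (B * A)ᵀ = B * A

theorem IsMoorePenroseInverse.unique {m n : Type*} [Fintype m] [Fintype n]
    {A : Matrix m n ℝ} {B C : Matrix n m ℝ}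
    (hB : IsMoorePenroseInverse A B) (hC : IsMoorePenroseInverse A C) : B = C := by
  have h1 : A * B = A * C := by
    calc A * B = (A * B)ᵀ := hB.symm_left.symm
      _ = (A * C * A * B)ᵀ := by rw [hC.mul_mul_left]
      _ = (A * B)ᵀ * (A * C)ᵀ := by rw [← Matrix.transpose_mul]; simp only [Matrix.mul_assoc]
      _ = A * B * A * C := by rw [hB.symm_left, hC.symm_left]; simp only [Matrix.mul_assoc]
      _ = A * C := by rw [hB.mul_mul_left]
  have h2 : B * A = C * A := by
    calc B * A = (B * A)ᵀ := hB.symm_right.symm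
      _ = (B * (A * C * A))ᵀ := by rw [hC.mul_mul_left]
      _ = (C * A)ᵀ * (B * A)ᵀ := by rw [← Matrix.transpose_mul]; simp only [Matrix.mul_assoc]
      _ = C * (A * B * A) := by
          rw [hB.symm_right, hC.symm_right]; simp only [Matrix.mul_assoc]
      _ = C * A := by rw [hB.mul_mul_left]
  calc B = B * A * B := hB.mul_mul_right.symm
    _ = C * (A * B) := by rw [h2, Matrix.mul_assoc]
    _ = C := by rw [h1, ← Matrix.mul_assoc, hC.mul_mul_right]

theorem exists_isMoorePenroseInverse {m n : Type*} [Fintype m] [Fintype n] [DecidableEq n]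
    (A : Matrix m n ℝ) : ∃ B, IsMoorePenroseInverse A B := by
  have hH : (Aᵀ * A).IsHermitian := by
    simpa using Matrix.isHermitian_conjTranspose_mul_self A
  obtain ⟨V, d, hV, hVd⟩ : ∃ (V : Matrix n n ℝ) (d : n → ℝ), Vᵀ * V = 1 ∧
      Aᵀ * A = V * Matrix.diagonal d * Vᵀ := by
    refine ⟨hH.eigenvectorUnitary, hH.eigenvalues, ?_, ?_⟩
    · simpa [Matrix.star_eq_conjTranspose] using
        Unitary.coe_star_mul_self hH.eigenvectorUnitary
    · simpa [Matrix.star_eq_conjTranspose, Function.comp_def, Unitary.conjStarAlgAut_apply] using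
        hH.spectral_theorem
  have key : ∀ a b : n → ℝ, (V * Matrix.diagonal a * Vᵀ) * (V * Matrix.diagonal b * Vᵀ) =
      V * Matrix.diagonal (fun i => a i * b i) * Vᵀ := by
    intro a b
    calc _ = V * Matrix.diagonal a * (Vᵀ * V) * Matrix.diagonal b * Vᵀ := by
          simp only [Matrix.mul_assoc]
      _ = _ := by rw [hV, Matrix.mul_one, Matrix.mul_assoc V, Matrix.diagonal_mul_diagonal]
  have keyT : ∀ a : n → ℝ, (V * Matrix.diagonal a * Vᵀ)ᵀ = V * Matrix.diagonal a * Vᵀ := by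
    intro a
    simp [Matrix.transpose_mul, Matrix.mul_assoc]
  set G := V * Matrix.diagonal (fun i => (d i)⁻¹) * Vᵀ with hG
  set H := Aᵀ * A with hHdef
  have hGT : Gᵀ = G := keyT _
  have hHT : Hᵀ = H := by simp [hHdef, Matrix.transpose_mul]
  have hHGH : H * G * H = H := by
    rw [hVd, hG, key, key]
    congr 3
    ext i
    by_cases h : d i = 0 <;> simp [h]
  have hGHG : G * H * G = G := by
    rw [hVd, hG, key, key]
    congr 3
    ext i
    by_cases h : d i = 0 <;> simp [h]
  have hcomm : G * H = H * G := by
    rw [hVd, hG, key, key]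
    congr 3
    ext i
    ring
  have hA : A * (G * H) = A := by
    have h0 : (A * (G * H) - A)ᵀ * (A * (G * H) - A) = 0 := by
      have e : (A * (G * H) - A)ᵀ * (A * (G * H) - A) = (H * G - 1) * (H * G * H - H) := by
        rw [Matrix.transpose_sub, Matrix.transpose_mul, Matrix.transpose_mul, hGT, hHT]
        simp only [Matrix.sub_mul, Matrix.mul_sub, Matrix.one_mul]
        simp only [hHdef, Matrix.mul_assoc]
      rw [e, hHGH, sub_self, Matrix.mul_zero]
    have h1 : A * (G * H) - A = 0 := by
      have := Matrix.conjTranspose_mul_self_eq_zero (A := A * (G * H) - A)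
      rw [Matrix.conjTranspose_eq_transpose_of_trivial] at this
      exact this.1 h0
    exact sub_eq_zero.1 h1
  refine ⟨G * Aᵀ, ?_, ?_, ?_, ?_⟩
  · calc A * (G * Aᵀ) * A = A * (G * H) := by simp only [hHdef, Matrix.mul_assoc]
      _ = A := hA
  · calc G * Aᵀ * A * (G * Aᵀ) = G * H * G * Aᵀ := by simp only [hHdef, Matrix.mul_assoc]
      _ = G * Aᵀ := by rw [hGHG]
  · simp [Matrix.transpose_mul, hGT, Matrix.mul_assoc]
  · have : G * Aᵀ * A = G * H := by simp only [hHdef, Matrix.mul_assoc]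
    rw [this, Matrix.transpose_mul, hGT, hHT, hcomm]

/-- The Moore-Penrose inverse `A†` of a real matrix. -/
noncomputable def moorePenrose {m n : Type*} [Fintype m] [Fintype n] [DecidableEq n]
    (A : Matrix m n ℝ) : Matrix n m ℝ :=
  Classical.choose (exists_isMoorePenroseInverse A)

theorem moorePenrose_spec {m n : Type*} [Fintype m] [Fintype n] [DecidableEq n]
    (A : Matrix m n ℝ) : IsMoorePenroseInverse A (moorePenrose A) :=
  Classical.choose_spec (exists_isMoorePenroseInverse A)

/-! ### Singular values and Euclidean Hessian -/

/-- The `i`-th largest singular value `σ_i(X)`, numbered from `i = 1`. -/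
noncomputable def sigma {m n : ℕ} (i : ℕ) (X : Matrix (Fin m) (Fin n) ℝ) : ℝ :=
  (Matrix.toEuclideanLin X).singularValues (i - 1)

section Riemannian

variable {E : Type*} [NormedAddCommGroup E] [InnerProductSpace ℝ E] [FiniteDimensional ℝ E]

/-- The Euclidean Hessian `∇²g(y)`, as the linear operator that is the derivative of the
gradient field `∇g`. Its bilinear form is `∇²g(y)[a, b] = ⟨∇²g(y)[a], b⟩`. -/
noncomputable def euclideanHessian (g : E → ℝ) (y : E) : E →L[ℝ] E :=
  fderiv ℝ (gradient g) y

/-! ### Riemannian geometry of submanifolds of a Euclidean space -/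

/-- The tangent space at `x` of a submanifold `M` of a Euclidean space: the velocities at `x` of
the smooth curves that run in `M`. (For a submanifold these velocities already form a linear
subspace, so that the span adds nothing.) -/
def tangentSpaceAt (M : Set E) (x : E) : Submodule ℝ E :=
  Submodule.span ℝ {v | ∃ γ : ℝ → E, ContDiff ℝ ∞ γ ∧ γ 0 = x ∧ (∀ᶠ t in 𝓝 0, γ t ∈ M) ∧
    HasDerivAt γ v 0}

/-- The Riemannian gradient at `x` of `f` on the submanifold `M` with the induced metric: the
unique tangent vector with `⟨grad f(x), z⟩ = D f(x)[z]` for all tangent vectors `z` (the Riesz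
representative of the derivative of `f` on the tangent space). -/
noncomputable def riemannianGrad (M : Set E) (f : E → ℝ) (x : E) : tangentSpaceAt M x :=
  (InnerProductSpace.toDual ℝ (tangentSpaceAt M x)).symm
    ((fderiv ℝ f x).comp (tangentSpaceAt M x).subtypeL)

/-- The vector field `grad f` along `M` is differentiable at `x`. -/
def RiemannianGradDifferentiableAt (M : Set E) (f : E → ℝ) (x : E) : Prop :=
  DifferentiableWithinAt ℝ (fun z => (riemannianGrad M f z : E)) M x

/-- The Riemannian Hessian at `x` of `f` on the submanifold `M` with the induced metric: the
covariant derivative of the vector field `grad f` in the direction of a tangent vector. The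
Riemannian connection of a submanifold of a Euclidean space is the tangential part of the
directional derivative of a vector field along `M`. On tangent directions, the derivative within
`M` depends only on the vector field along `M`. -/
noncomputable def riemannianHess (M : Set E) (f : E → ℝ) (x : E) :
    tangentSpaceAt M x →L[ℝ] tangentSpaceAt M x :=
  (tangentSpaceAt M x).orthogonalProjectionOnto.comp
    ((fderivWithin ℝ (fun z => (riemannianGrad M f z : E)) M x).comp
      (tangentSpaceAt M x).subtypeL)

end Riemannian

/-- The set of `p × p` real symmetric positive semidefinite matrices of rank `r`. -/
def psdManifold (p r : ℕ) : Set (Matrix (Fin p) (Fin p) ℝ) :=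
  {X | X.PosSemidef ∧ X.rank = r}

/-- The factorized objective `g(Y) = f(Y Yᵀ)` on `p × r` matrices. -/
def factorized {p : ℕ} (r : ℕ) (f : Matrix (Fin p) (Fin p) ℝ → ℝ) :
    Matrix (Fin p) (Fin r) ℝ → ℝ :=
  fun Y => f (Y * Yᵀ)

/-! ### The linear maps and subspaces attached to an eigendecomposition -/

/-- An economic eigendecomposition `X = U Σ Uᵀ`, where `U` has `r` orthonormal columns and
`Σ = diag(d)` has non-increasing diagonal, together with an orthonormal complement `U_⊥` of `U`.
(If `X` is positive semidefinite of rank `r`, then all `d i` are positive.) -/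
structure EigDecomp {p : ℕ} (X : Matrix (Fin p) (Fin p) ℝ) (r : ℕ) where
  U : Matrix (Fin p) (Fin r) ℝ
  Uperp : Matrix (Fin p) (Fin (p - r)) ℝ
  d : Fin r → ℝ
  orthonormal_U : Uᵀ * U = 1
  orthonormal_Uperp : Uperpᵀ * Uperp = 1
  orthogonal : Uᵀ * Uperp = 0
  antitone_d : Antitone d
  eq_mul : X = U * Matrix.diagonal d * Uᵀ

namespace EigDecomp

variable {p r : ℕ} {X : Matrix (Fin p) (Fin p) ℝ} (D : EigDecomp X r)

/-- `P = Uᵀ Y`. -/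
def P (Y : Matrix (Fin p) (Fin r) ℝ) : Matrix (Fin r) (Fin r) ℝ := D.Uᵀ * Y

/-- `ξ_Y^A = [U U_⊥] [[P Aᵀ U + Uᵀ A Pᵀ, P Aᵀ U_⊥], [U_⊥ᵀ A Pᵀ, 0]] [U U_⊥]ᵀ`. -/
def xi (Y A : Matrix (Fin p) (Fin r) ℝ) : Matrix (Fin p) (Fin p) ℝ :=
  Matrix.fromCols D.U D.Uperp *
    Matrix.fromBlocks (D.P Y * Aᵀ * D.U + D.Uᵀ * A * (D.P Y)ᵀ) (D.P Y * Aᵀ * D.Uperp)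
      (D.Uperpᵀ * A * (D.P Y)ᵀ) 0 *
    (Matrix.fromCols D.U D.Uperp)ᵀ

/-- The null space `{U S P⁻ᵀ : S + Sᵀ = 0}`. -/
noncomputable def nullSpace (Y : Matrix (Fin p) (Fin r) ℝ) :
    Submodule ℝ (Matrix (Fin p) (Fin r) ℝ) where
  carrier := {A | ∃ S : Matrix (Fin r) (Fin r) ℝ, S + Sᵀ = 0 ∧ A = D.U * S * ((D.P Y)⁻¹)ᵀ}
  zero_mem' := ⟨0, by simp, by simp⟩
  add_mem' := by
    rintro _ _ ⟨S, hS, rfl⟩ ⟨T, hT, rfl⟩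
    refine ⟨S + T, ?_, by simp [Matrix.mul_add, Matrix.add_mul]⟩
    rw [Matrix.transpose_add, add_add_add_comm, hS, hT, add_zero]
  smul_mem' := by
    rintro c _ ⟨S, hS, rfl⟩
    refine ⟨c • S, ?_, by simp⟩
    rw [Matrix.transpose_smul, ← smul_add, hS, smul_zero]

/-- The complementary space `{(U S + U_⊥ D) P⁻ᵀ : S Σ⁻¹ symmetric, D arbitrary}`. -/
noncomputable def nonNullSpace (Y : Matrix (Fin p) (Fin r) ℝ) :
    Submodule ℝ (Matrix (Fin p) (Fin r) ℝ) where
  carrier := {A | ∃ (S : Matrix (Fin r) (Fin r) ℝ) (C : Matrix (Fin (p - r)) (Fin r) ℝ),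
    (S * (Matrix.diagonal D.d)⁻¹).IsSymm ∧ A = (D.U * S + D.Uperp * C) * ((D.P Y)⁻¹)ᵀ}
  zero_mem' := ⟨0, 0, by simp [Matrix.IsSymm], by simp⟩
  add_mem' := by
    rintro _ _ ⟨S, C, hS, rfl⟩ ⟨T, B, hT, rfl⟩
    refine ⟨S + T, C + B, ?_, ?_⟩
    · rw [Matrix.add_mul]; exact hS.add hT
    · simp only [Matrix.mul_add, Matrix.add_mul]; abel
  smul_mem' := by
    rintro c _ ⟨S, C, hS, rfl⟩
    refine ⟨c • S, c • C, ?_, ?_⟩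
    · rw [Matrix.smul_mul]; exact hS.smul c
    · simp [Matrix.add_mul]

end EigDecomp

/-!
The factorization `φ(Y) = Y Yᵀ` has derivative `ξ_A = A Yᵀ + Y Aᵀ` in the direction `A`
(`factorDerivative`), and everything rests on comparing `g = f ∘ φ` with `f` on the manifold
through this linear map.

**Tangent spaces.** Let `Q` be the orthogonal projection onto the column space of `Z`. A matrix `v`
is tangent at `Z` if and only if it is symmetric and `(1 - Q) v (1 - Q) = 0`
(`mem_tangentSpaceAt_iff`). Necessity holds because `xᵀ γ(t) x` is minimal at `t = 0` for `x` in the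
kernel of `Z`; sufficiency because such a `v` is the velocity of a congruence curve
`(1 + tB) Z (1 + tB)ᵀ`. Hence `grad f(Z) = G - (1 - Q) G (1 - Q)` with `G = ∇f(Z)`
(`riemannianGrad_eq`), while `∇g(Y) = 2 G Y` (`gradient_factorized`); this gives both gradient
identities. Near `X = Y Yᵀ` the columns of `Z Y` span the column space of `Z`, so that `Q` is a
differentiable function of `Z` (`isColumnProjection_of_det_ne_zero`) and so is `grad f`.

**Hessians.** The identity `∇g(Y + tA) = 2 grad f(φ(Y + tA)) (Y + tA)` holds for all small `t`. If
`∇g(Y) = 0`, then `grad f(X) = 0`, and differentiating at `t = 0` gives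
`∇²g(Y)[A, B] = Hess f(X)[ξ_A, ξ_B]` (`inner_euclideanHessian_eq_riemannianHess`). The kernel of
`A ↦ ξ_A` is `{Y T : T skew}`, of dimension `(r² - r) / 2`, and its orthogonal complement
`{A : YᵀA symmetric}` is mapped bijectively onto the tangent space (`horizontalEquiv`). In the
coordinates of an eigendecomposition these two spaces are `nullSpace` and `nonNullSpace`, and `ξ_A`
is `EigDecomp.xi`.

**Eigenvalues.** The Hessian of `g` vanishes on the kernel, so its remaining eigenvalues are those
of its restriction to the complement. If `YᵀA` is symmetric, then
`‖ξ_A‖² = 2 ‖A Yᵀ‖² + 2 ‖YᵀA‖²` lies between `2 σ_r(X) ‖A‖²` and `4 σ_1(X) ‖A‖²`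
(`norm_sq_factorDerivative_mem_Icc`), and the min-max principle turns this comparison of norms into
the comparison of ordered eigenvalues
(`LinearMap.IsSymmetric.eigenvalues_mem_uIcc_of_congruence`).
-/

/-! ### Eigenvalues of symmetric operators related by a congruence -/

section Congruence

variable {E F : Type*} [NormedAddCommGroup E] [InnerProductSpace ℝ E] [FiniteDimensional ℝ E]
  [NormedAddCommGroup F] [InnerProductSpace ℝ F] [FiniteDimensional ℝ F]

theorem LinearMap.IsSymmetric.inner_apply_self_eq_sum {S : E →ₗ[ℝ] E} (hS : S.IsSymmetric) {n : ℕ}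
    (hE : Module.finrank ℝ E = n) (x : E) :
    inner ℝ (S x) x = ∑ j, hS.eigenvalues hE j * inner ℝ (hS.eigenvectorBasis hE j) x ^ 2 := by
  rw [← (hS.eigenvectorBasis hE).sum_inner_mul_inner]
  refine Finset.sum_congr rfl fun j _ => ?_
  rw [hS, hS.apply_eigenvectorBasis, inner_smul_right, real_inner_comm]
  simp only [RCLike.ofReal_real_eq_id, id_eq]
  ring

/-- The dimension count behind the min-max principle: the span of the eigenvectors `0, …, i` of
`S` meets the preimage under `L` of the span of the eigenvectors `i, …, n - 1` of `T`. -/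
theorem exists_ne_zero_eigenvalue_mul_le_inner {S : E →ₗ[ℝ] E} {T : F →ₗ[ℝ] F}
    (hS : S.IsSymmetric) (hT : T.IsSymmetric) {n : ℕ} (hE : Module.finrank ℝ E = n)
    (hF : Module.finrank ℝ F = n) (L : E →ₗ[ℝ] F) (i : Fin n) :
    ∃ x : E, x ≠ 0 ∧ hS.eigenvalues hE i * ‖x‖ ^ 2 ≤ inner ℝ (S x) x ∧
      inner ℝ (T (L x)) (L x) ≤ hT.eigenvalues hF i * ‖L x‖ ^ 2 := by
  -- The conditions `⟪b_j, x⟫ = 0` for `j > i` and `⟪c_j, L x⟫ = 0` for `j < i` are only `n - 1`.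
  let φ : E →ₗ[ℝ] ({j : Fin n // j ≠ i} → ℝ) := LinearMap.pi fun j =>
    if i < j then (innerSL ℝ (hS.eigenvectorBasis hE j)).toLinearMap
    else (innerSL ℝ (hT.eigenvectorBasis hF j)).toLinearMap ∘ₗ L
  have hker : LinearMap.ker φ ≠ ⊥ := by
    apply LinearMap.ker_ne_bot_of_finrank_lt
    rw [Module.finrank_fintype_fun_eq_card, hE, Fintype.card_subtype_compl]
    have := i.pos
    simp
    omega
  obtain ⟨x, hx, hx0⟩ := Submodule.exists_mem_ne_zero_of_ne_bot hker
  have hφ : ∀ j (hj : j ≠ i), φ x ⟨j, hj⟩ = 0 := fun j hj => by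
    rw [LinearMap.mem_ker.1 hx, Pi.zero_apply]
  refine ⟨x, hx0, ?_, ?_⟩
  · rw [hS.inner_apply_self_eq_sum hE, ← (hS.eigenvectorBasis hE).sum_sq_inner_right,
      Finset.mul_sum]
    refine Finset.sum_le_sum fun j _ => ?_
    rcases le_or_gt j i with h | h
    · exact mul_le_mul_of_nonneg_right (hS.eigenvalues_antitone hE h) (sq_nonneg _)
    · have := hφ j h.ne'
      simp [φ, h] at this
      simp [this]
  · rw [hT.inner_apply_self_eq_sum hF, ← (hT.eigenvectorBasis hF).sum_sq_inner_right,
      Finset.mul_sum]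
    refine Finset.sum_le_sum fun j _ => ?_
    rcases le_or_gt i j with h | h
    · exact mul_le_mul_of_nonneg_right (hT.eigenvalues_antitone hF h) (sq_nonneg _)
    · have := hφ j h.ne
      simp [φ, h.not_gt] at this
      simp [this]

/-- Ostrowski's quantitative form of Sylvester's law of inertia: a congruence with squared
singular values between `m` and `M` multiplies each ordered eigenvalue by a factor between `m`
and `M`. -/
theorem LinearMap.IsSymmetric.eigenvalues_mem_uIcc_of_congruence {S : E →ₗ[ℝ] E} {T : F →ₗ[ℝ] F}
    (hS : S.IsSymmetric) (hT : T.IsSymmetric) {n : ℕ} (hE : Module.finrank ℝ E = n)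
    (hF : Module.finrank ℝ F = n) (L : E ≃ₗ[ℝ] F)
    (hL : ∀ x, inner ℝ (S x) x = inner ℝ (T (L x)) (L x)) {m M : ℝ}
    (hm : ∀ x, m * ‖x‖ ^ 2 ≤ ‖L x‖ ^ 2) (hM : ∀ x, ‖L x‖ ^ 2 ≤ M * ‖x‖ ^ 2) (i : Fin n) :
    hS.eigenvalues hE i ∈ Set.uIcc (m * hT.eigenvalues hF i) (M * hT.eigenvalues hF i) := by
  set s := hS.eigenvalues hE i
  set t := hT.eigenvalues hF i
  have ratio : ∀ x : E, x ≠ 0 → ∃ ρ ∈ Set.Icc m M, ‖L x‖ ^ 2 = ρ * ‖x‖ ^ 2 ∧ 0 < ‖x‖ ^ 2 := by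
    intro x hx
    have hx' : 0 < ‖x‖ ^ 2 := by positivity
    exact ⟨‖L x‖ ^ 2 / ‖x‖ ^ 2, ⟨(le_div_iff₀ hx').2 (hm x), (div_le_iff₀ hx').2 (hM x)⟩,
      by field_simp, hx'⟩
  have mem : ∀ ρ ∈ Set.Icc m M, ρ * t ∈ Set.uIcc (m * t) (M * t) := by
    intro ρ hρ
    rw [Set.mem_uIcc]
    rcases le_total 0 t with ht | ht
    · exact Or.inl ⟨mul_le_mul_of_nonneg_right hρ.1 ht, mul_le_mul_of_nonneg_right hρ.2 ht⟩
    · exact Or.inr ⟨mul_le_mul_of_nonpos_right hρ.2 ht, mul_le_mul_of_nonpos_right hρ.1 ht⟩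
  obtain ⟨x, hx, h1, h2⟩ := exists_ne_zero_eigenvalue_mul_le_inner hS hT hE hF L.toLinearMap i
  obtain ⟨y, hy, h3, h4⟩ :=
    exists_ne_zero_eigenvalue_mul_le_inner hT hS hF hE L.symm.toLinearMap i
  obtain ⟨ρ, hρ, hρx, hxpos⟩ := ratio x hx
  obtain ⟨ρ', hρ', hρy, hypos⟩ := ratio (L.symm y) (by simpa using hy)
  have hup : s ≤ ρ * t := by
    refine le_of_mul_le_mul_right ?_ hxpos
    calc s * ‖x‖ ^ 2 ≤ t * ‖L x‖ ^ 2 := h1.trans ((hL x).le.trans h2)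
      _ = ρ * t * ‖x‖ ^ 2 := by rw [hρx]; ring
  have hlow : ρ' * t ≤ s := by
    refine le_of_mul_le_mul_right ?_ hypos
    have h5 := hL (L.symm y)
    rw [L.apply_symm_apply] at h5 hρy
    calc ρ' * t * ‖L.symm y‖ ^ 2 = t * ‖y‖ ^ 2 := by rw [hρy]; ring
      _ ≤ s * ‖L.symm y‖ ^ 2 := h3.trans (h5.symm.le.trans h4)
  exact Set.ordConnected_uIcc.out (mem ρ' hρ') (mem ρ hρ) ⟨hlow, hup⟩

theorem LinearMap.charpoly_eq_prod_of_basis {ι : Type*} [Fintype ι] (T : E →ₗ[ℝ] E)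
    (b : Module.Basis ι ℝ E) (μ : ι → ℝ) (h : ∀ i, T (b i) = μ i • b i) :
    T.charpoly = ∏ i, (Polynomial.X - Polynomial.C (μ i)) := by
  classical
  have : LinearMap.toMatrix b b T = Matrix.diagonal μ := by
    ext i j
    rw [LinearMap.toMatrix_apply, h, map_smul, Finsupp.smul_apply, b.repr_self,
      Matrix.diagonal_apply, Finsupp.single_apply]
    by_cases hij : i = j <;> simp [hij, eq_comm]
  rw [← LinearMap.charpoly_toMatrix T b, this, Matrix.charpoly_diagonal]

/-- Splitting off a subspace `K` of the kernel: the remaining eigenvalues are those of the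
restriction `S` to the orthogonal complement. -/
theorem LinearMap.IsSymmetric.eigenvalues_eq_replicate_zero_add {T : E →ₗ[ℝ] E}
    (hT : T.IsSymmetric) {n k l : ℕ} (hE : Module.finrank ℝ E = n) (K : Submodule ℝ E)
    (hK : K ≤ LinearMap.ker T) (hk : Module.finrank ℝ K = k) {S : Kᗮ →ₗ[ℝ] Kᗮ}
    (hS : S.IsSymmetric) (hl : Module.finrank ℝ Kᗮ = l) (hST : ∀ x : Kᗮ, (S x : E) = T x) :
    Multiset.map (hT.eigenvalues hE) Finset.univ.val =
      Multiset.replicate k 0 + Multiset.map (hS.eigenvalues hl) Finset.univ.val := by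
  let c : Module.Basis (Fin k ⊕ Fin l) ℝ E :=
    (((Module.finBasisOfFinrankEq ℝ K hk).prod (hS.eigenvectorBasis hl).toBasis).map
      (Submodule.prodEquivOfIsCompl K Kᗮ K.isCompl_orthogonal))
  have h1 := T.charpoly_eq_prod_of_basis c (Sum.elim (fun _ => 0) (hS.eigenvalues hl)) (by
    rintro (i | i)
    · have : T (c (Sum.inl i)) = 0 := hK (by simp [c])
      simpa using this
    · simp only [Sum.elim_inr]
      have : c (Sum.inr i) = (hS.eigenvectorBasis hl i : E) := by simp [c]
      rw [this, ← hST, hS.apply_eigenvectorBasis]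
      rfl)
  have h2 := T.charpoly_eq_prod_of_basis (hT.eigenvectorBasis hE).toBasis (hT.eigenvalues hE)
    (fun i => by simp)
  have hroots : ∀ {ι : Type} [Fintype ι] (μ : ι → ℝ),
      (∏ i, (Polynomial.X - Polynomial.C (μ i))).roots = Multiset.map μ Finset.univ.val :=
    fun μ => by
      rw [← Polynomial.roots_multiset_prod_X_sub_C (Multiset.map μ Finset.univ.val),
        Multiset.map_map]
      rfl
  rw [← hroots, ← h2, h1, Fintype.prod_sum_type, Polynomial.roots_mul, hroots]
  · congr 1
    · simp
    · exact hroots _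
  · rw [Fintype.prod_sum_type] at h1
    rw [← h1]
    exact T.charpoly_monic.ne_zero

end Congruence

/-! ### The trace inner product and differentiation of matrix expressions -/

section MatrixManifold

/-- The topology of the Frobenius norm. It agrees with the entrywise topology; as an instance it
keeps derivatives of matrix-valued functions in the normed setting. -/
noncomputable abbrev frobeniusTopologicalSpace (m n : Type*) [Fintype m] [Fintype n] :
    TopologicalSpace (Matrix m n ℝ) :=
  (Matrix.frobeniusNormedAddCommGroup :
    NormedAddCommGroup (Matrix m n ℝ)).toPseudoMetricSpace.toUniformSpace.toTopologicalSpace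

attribute [local instance] frobeniusTopologicalSpace

section Calculus

variable {l m n : Type*} [Fintype l] [Fintype m] [Fintype n]

theorem matrix_inner_def (A B : Matrix m n ℝ) : inner ℝ A B = (Aᵀ * B).trace := rfl

theorem matrix_inner_transpose (A B : Matrix m n ℝ) : inner ℝ Aᵀ Bᵀ = inner ℝ A B := by
  rw [matrix_inner_def, matrix_inner_def, ← Matrix.trace_transpose, Matrix.transpose_mul,
    Matrix.transpose_transpose, Matrix.transpose_transpose, Matrix.trace_mul_comm]

theorem matrix_inner_mul_right (A : Matrix m n ℝ) (B : Matrix m l ℝ) (C : Matrix l n ℝ) :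
    inner ℝ A (B * C) = inner ℝ (Bᵀ * A) C := by
  simp [matrix_inner_def, Matrix.transpose_mul, Matrix.mul_assoc]

theorem matrix_inner_mul_left (A : Matrix m n ℝ) (B : Matrix m l ℝ) (C : Matrix l n ℝ) :
    inner ℝ A (B * C) = inner ℝ (A * Cᵀ) B := by
  rw [matrix_inner_def, matrix_inner_def, Matrix.transpose_mul, Matrix.transpose_transpose,
    Matrix.mul_assoc C, Matrix.trace_mul_comm C, Matrix.mul_assoc]

/-- Matrix multiplication as a continuous bilinear map for the Frobenius norms. -/
noncomputable def matrixMulCLM (l m n : Type*) [Fintype l] [Fintype m] [Fintype n] :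
    Matrix l m ℝ →L[ℝ] Matrix m n ℝ →L[ℝ] Matrix l n ℝ :=
  (LinearMap.mk₂ ℝ (fun (A : Matrix l m ℝ) (B : Matrix m n ℝ) => A * B) Matrix.add_mul
    (fun c A B => Matrix.smul_mul c A B) Matrix.mul_add
    (fun c A B => Matrix.mul_smul A c B)).toContinuousBilinearMap

/-- Transposition as a continuous linear map for the Frobenius norms. -/
noncomputable def matrixTransposeCLM (m n : Type*) [Fintype m] [Fintype n] :
    Matrix m n ℝ →L[ℝ] Matrix n m ℝ :=
  (Matrix.transposeLinearEquiv m n ℝ ℝ).toLinearMap.toContinuousLinearMap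

theorem ContDiff.matrix_mul_transpose {k : WithTop ℕ∞} :
    ContDiff ℝ k (fun A : Matrix m n ℝ => A * Aᵀ) :=
  (matrixMulCLM m n m).isBoundedBilinearMap.contDiff.comp
    (contDiff_id.prodMk (matrixTransposeCLM m n).contDiff)

variable {E : Type*} [NormedAddCommGroup E] [NormedSpace ℝ E]

theorem DifferentiableAt.matrix_mul {u : E → Matrix l m ℝ} {v : E → Matrix m n ℝ} {x : E}
    (hu : DifferentiableAt ℝ u x) (hv : DifferentiableAt ℝ v x) :
    DifferentiableAt ℝ (fun y => u y * v y) x :=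
  ((matrixMulCLM l m n).isBoundedBilinearMap.differentiableAt (u x, v x)).comp
    (f := fun y => (u y, v y)) x (hu.prodMk hv)

theorem DifferentiableAt.matrix_transpose {u : E → Matrix m n ℝ} {x : E}
    (hu : DifferentiableAt ℝ u x) : DifferentiableAt ℝ (fun y => (u y)ᵀ) x :=
  (matrixTransposeCLM m n).differentiableAt.comp x hu

theorem DifferentiableAt.matrix_inv [DecidableEq n] {u : E → Matrix n n ℝ} {x : E}
    (hu : DifferentiableAt ℝ u x) (h : (u x).det ≠ 0) :
    DifferentiableAt ℝ (fun y => (u y)⁻¹) x := by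
  let : NormedRing (Matrix n n ℝ) := Matrix.frobeniusNormedRing
  let : NormedAlgebra ℝ (Matrix n n ℝ) := Matrix.frobeniusNormedAlgebra
  have h1 : DifferentiableAt ℝ (Ring.inverse : Matrix n n ℝ → Matrix n n ℝ) (u x) :=
    differentiableAt_inverse ((Matrix.isUnit_iff_isUnit_det _).2 h.isUnit)
  simp only [Matrix.nonsing_inv_eq_ringInverse]
  exact h1.comp x hu

theorem HasDerivAt.matrix_mul {u : ℝ → Matrix l m ℝ} {v : ℝ → Matrix m n ℝ} {t : ℝ}
    {u' : Matrix l m ℝ} {v' : Matrix m n ℝ} (hu : HasDerivAt u u' t) (hv : HasDerivAt v v' t) :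
    HasDerivAt (fun s => u s * v s) (u t * v' + u' * v t) t :=
  (matrixMulCLM l m n).hasDerivAt_of_bilinear (fun _ => hu) (fun _ => hv)

theorem HasDerivAt.matrix_transpose {u : ℝ → Matrix m n ℝ} {t : ℝ} {u' : Matrix m n ℝ}
    (hu : HasDerivAt u u' t) : HasDerivAt (fun s => (u s)ᵀ) u'ᵀ t :=
  (matrixTransposeCLM m n).hasFDerivAt.comp_hasDerivAt t hu

theorem hasDerivAt_add_smul (A B : Matrix m n ℝ) :
    HasDerivAt (fun t : ℝ => A + t • B) B 0 := by
  have h := ((hasDerivAt_id (0 : ℝ)).smul_const B).const_add A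
  rwa [one_smul] at h

end Calculus

/-! ### Tangent spaces of the manifold of positive semidefinite matrices of fixed rank -/

section Tangent

variable {p r : ℕ}

theorem isSymm_of_mem_psdManifold {Z : Matrix (Fin p) (Fin p) ℝ} (hZ : Z ∈ psdManifold p r) :
    Zᵀ = Z := by
  simpa using hZ.1.isHermitian.eq

/-- Congruences `t ↦ (1 + tB) Z (1 + tB)ᵀ` keep the rank as long as `1 + tB` is invertible. -/
theorem mul_add_mul_transpose_mem_tangentSpaceAt {Z : Matrix (Fin p) (Fin p) ℝ}
    (hZ : Z ∈ psdManifold p r) (B : Matrix (Fin p) (Fin p) ℝ) :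
    B * Z + Z * Bᵀ ∈ tangentSpaceAt (psdManifold p r) Z := by
  refine Submodule.subset_span ⟨fun t => (1 + t • B) * Z * (1 + t • B)ᵀ, ?_, by simp, ?_, ?_⟩
  · have : (fun t : ℝ => (1 + t • B) * Z * (1 + t • B)ᵀ) =
        fun t : ℝ => Z + t • (B * Z + Z * Bᵀ) + t ^ 2 • (B * Z * Bᵀ) := by
      funext t
      simp only [Matrix.transpose_add, Matrix.transpose_one, Matrix.transpose_smul, Matrix.add_mul,
        Matrix.mul_add, Matrix.one_mul, Matrix.mul_one, Matrix.smul_mul, Matrix.mul_smul, smul_smul,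
        smul_add, sq]
      abel
    rw [this]
    fun_prop
  · have hdet : ∀ᶠ t : ℝ in 𝓝 0, (1 + t • B).det ≠ 0 := by
      have : ContinuousAt (fun t : ℝ => (1 + t • B).det) 0 := by fun_prop
      exact this.eventually_ne (by simp)
    filter_upwards [hdet] with t ht
    refine ⟨?_, ?_⟩
    · exact hZ.1.mul_mul_conjTranspose_same (1 + t • B)
    · have h1 : (1 + t • B)ᵀ.det ≠ 0 := by rwa [Matrix.det_transpose]
      exact (Matrix.rank_mul_eq_left_of_det_ne_zero _ _ h1).trans
        ((Matrix.rank_mul_eq_right_of_det_ne_zero _ _ ht).trans hZ.2)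
  · have h1 := hasDerivAt_add_smul 1 B
    have h2 := (h1.matrix_mul (hasDerivAt_const (0 : ℝ) Z)).matrix_mul h1.matrix_transpose
    simpa [add_comm] using h2

theorem tangentSpaceAt_le_symm {Z v : Matrix (Fin p) (Fin p) ℝ}
    (hv : v ∈ tangentSpaceAt (psdManifold p r) Z) : vᵀ = v := by
  induction hv using Submodule.span_induction with
  | mem v h =>
    obtain ⟨γ, -, -, hM, hd⟩ := h
    refine (hd.matrix_transpose.congr_of_eventuallyEq ?_).unique hd
    filter_upwards [hM] with t ht
    exact (isSymm_of_mem_psdManifold ht).symm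
  | zero => simp
  | add v w _ _ hv hw => rw [Matrix.transpose_add, hv, hw]
  | smul c v _ hv => rw [Matrix.transpose_smul, hv]

/-- For `x` in the kernel of `Z`, the function `t ↦ xᵀ γ(t) x` along a curve of positive
semidefinite matrices through `Z` has a minimum at `Z`. -/
theorem dotProduct_mulVec_eq_zero_of_mem_tangentSpaceAt {Z v : Matrix (Fin p) (Fin p) ℝ}
    (hv : v ∈ tangentSpaceAt (psdManifold p r) Z) {x : Fin p → ℝ} (hx : Z *ᵥ x = 0) :
    x ⬝ᵥ (v *ᵥ x) = 0 := by
  let φ : Matrix (Fin p) (Fin p) ℝ →ₗ[ℝ] ℝ :=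
    { toFun := fun V => x ⬝ᵥ (V *ᵥ x)
      map_add' := fun V W => by rw [Matrix.add_mulVec, dotProduct_add]
      map_smul' := fun c V => by simp [Matrix.smul_mulVec] }
  change φ v = 0
  induction hv using Submodule.span_induction with
  | mem v h =>
    obtain ⟨γ, -, h0, hM, hd⟩ := h
    have hd' : HasDerivAt (fun t => φ (γ t)) (φ v) 0 :=
      φ.toContinuousLinearMap.hasFDerivAt.comp_hasDerivAt 0 hd
    refine IsLocalMin.hasDerivAt_eq_zero ?_ hd'
    filter_upwards [hM] with t ht
    have : φ (γ 0) = 0 := by simp [φ, h0, hx]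
    rw [this]
    exact ht.1.dotProduct_mulVec_nonneg x
  | zero => simp
  | add v w _ _ hv hw => rw [map_add, hv, hw, add_zero]
  | smul c v _ hv => rw [map_smul, hv, smul_zero]

/-- `Q` is the orthogonal projection onto the column space of the symmetric matrix `Z`. -/
structure IsColumnProjection (Z Q : Matrix (Fin p) (Fin p) ℝ) : Prop where
  symm : Qᵀ = Q
  mul_self : Q * Z = Z
  exists_eq_mul : ∃ K, Q = Z * K

theorem IsColumnProjection.mul_proj {Z Q : Matrix (Fin p) (Fin p) ℝ} (hQ : IsColumnProjection Z Q) :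
    Q * Q = Q := by
  obtain ⟨K, hK⟩ := hQ.exists_eq_mul
  calc Q * Q = Q * Z * K := by rw [Matrix.mul_assoc, ← hK]
    _ = Q := by rw [hQ.mul_self, hK]

/-- The tangent space consists of the symmetric matrices that vanish as a form on the kernel of
`Z`. -/
theorem mem_tangentSpaceAt_iff {Z Q v : Matrix (Fin p) (Fin p) ℝ} (hZ : Z ∈ psdManifold p r)
    (hQ : IsColumnProjection Z Q) :
    v ∈ tangentSpaceAt (psdManifold p r) Z ↔ vᵀ = v ∧ (1 - Q) * v * (1 - Q) = 0 := by
  have hZs := isSymm_of_mem_psdManifold hZ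
  have hZQ : Z * Q = Z := by
    have := congrArg Matrix.transpose hQ.mul_self
    rwa [Matrix.transpose_mul, hQ.symm, hZs] at this
  constructor
  · intro hv
    have hs := tangentSpaceAt_le_symm hv
    refine ⟨hs, ?_⟩
    have hker : ∀ w, Z *ᵥ ((1 - Q) *ᵥ w) = 0 := fun w => by
      rw [Matrix.mulVec_mulVec, Matrix.mul_sub, Matrix.mul_one, hZQ, sub_self, Matrix.zero_mulVec]
    have hpol : ∀ a b, ((1 - Q) *ᵥ a) ⬝ᵥ (v *ᵥ ((1 - Q) *ᵥ b)) = 0 := by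
      intro a b
      have h1 := dotProduct_mulVec_eq_zero_of_mem_tangentSpaceAt hv (hker a)
      have h2 := dotProduct_mulVec_eq_zero_of_mem_tangentSpaceAt hv (hker b)
      have h3 := dotProduct_mulVec_eq_zero_of_mem_tangentSpaceAt hv (hker (a + b))
      have h4 : ((1 - Q) *ᵥ b) ⬝ᵥ (v *ᵥ ((1 - Q) *ᵥ a)) =
          ((1 - Q) *ᵥ a) ⬝ᵥ (v *ᵥ ((1 - Q) *ᵥ b)) := by
        rw [Matrix.dotProduct_mulVec, ← Matrix.mulVec_transpose, hs, dotProduct_comm]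
      simp only [Matrix.mulVec_add, add_dotProduct, dotProduct_add, h1, h2, h4] at h3
      linarith
    have hR : (1 - Q)ᵀ = 1 - Q := by rw [Matrix.transpose_sub, hQ.symm, Matrix.transpose_one]
    ext i j
    have := hpol (Pi.single i 1) (Pi.single j 1)
    rw [Matrix.mulVec_mulVec, dotProduct_comm, Matrix.dotProduct_mulVec, ← Matrix.mulVec_transpose,
      hR, Matrix.mulVec_mulVec, ← Matrix.mul_assoc] at this
    simpa using this
  · rintro ⟨hs, hv⟩
    obtain ⟨K, hK⟩ := hQ.exists_eq_mul
    have hKZ : Kᵀ * Z = Q := by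
      rw [← hQ.symm, hK, Matrix.transpose_mul, hZs]
    -- `v = Qv + vQ - QvQ`; the term `QvQ` is shared evenly between `BZ` and its transpose.
    set B := (v - (1 / 2 : ℝ) • (Q * v)) * Kᵀ with hB
    have hBZ : B * Z = v * Q - (1 / 2 : ℝ) • (Q * v * Q) := by
      rw [hB, Matrix.mul_assoc, hKZ, Matrix.sub_mul, Matrix.smul_mul]
    have hZB : Z * Bᵀ = Q * v - (1 / 2 : ℝ) • (Q * v * Q) := by
      have := congrArg Matrix.transpose hBZ
      simpa [Matrix.transpose_mul, hZs, hs, hQ.symm, Matrix.mul_assoc] using this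
    have : v = B * Z + Z * Bᵀ := by
      rw [hBZ, hZB]
      have h : v - v * Q - Q * v + Q * v * Q = 0 := by
        rw [← hv]; noncomm_ring
      have h2 : v * Q - (1 / 2 : ℝ) • (Q * v * Q) + (Q * v - (1 / 2 : ℝ) • (Q * v * Q)) =
          v * Q + Q * v - Q * v * Q := by module
      rw [h2, ← sub_eq_zero, ← h]
      abel
    rw [this]
    exact mul_add_mul_transpose_mem_tangentSpaceAt hZ B

end Tangent

/-! ### Euclidean and Riemannian gradients -/

section Gradient

variable {p r : ℕ}

theorem fderiv_eq_inner_gradient {E : Type*} [NormedAddCommGroup E] [InnerProductSpace ℝ E]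
    [FiniteDimensional ℝ E] (f : E → ℝ) (x v : E) :
    fderiv ℝ f x v = inner ℝ (gradient f x) v := by
  simp [gradient]

/-- A function invariant under transposition has symmetric gradients at symmetric matrices. -/
theorem gradient_transpose {f : Matrix (Fin p) (Fin p) ℝ → ℝ} (hfsymm : ∀ Z, f Z = f Zᵀ)
    {Z : Matrix (Fin p) (Fin p) ℝ} (hd : DifferentiableAt ℝ f Z) (hZ : Zᵀ = Z) :
    (gradient f Z)ᵀ = gradient f Z := by
  have h1 : HasFDerivAt f ((fderiv ℝ f Z).comp (matrixTransposeCLM (Fin p) (Fin p))) Z := by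
    have h2 : HasFDerivAt f (fderiv ℝ f Z) (matrixTransposeCLM (Fin p) (Fin p) Z) := by
      change HasFDerivAt f (fderiv ℝ f Z) Zᵀ
      rw [hZ]; exact hd.hasFDerivAt
    have h3 := h2.comp Z (matrixTransposeCLM (Fin p) (Fin p)).hasFDerivAt
    exact h3.congr_of_eventuallyEq (Filter.Eventually.of_forall hfsymm)
  have h4 := h1.unique hd.hasFDerivAt
  refine ext_inner_right ℝ fun v => ?_
  have h5 : fderiv ℝ f Z vᵀ = fderiv ℝ f Z v := congrArg (fun φ => φ v) h4
  rw [← fderiv_eq_inner_gradient, ← h5, fderiv_eq_inner_gradient, ← matrix_inner_transpose,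
    Matrix.transpose_transpose]

/-- The Riemannian gradient is the orthogonal projection `G - (1 - Q) G (1 - Q)` of the Euclidean
gradient `G` onto the tangent space. -/
theorem riemannianGrad_eq {f : Matrix (Fin p) (Fin p) ℝ → ℝ} (hfsymm : ∀ Z, f Z = f Zᵀ)
    {Z Q : Matrix (Fin p) (Fin p) ℝ} (hd : DifferentiableAt ℝ f Z) (hZ : Z ∈ psdManifold p r)
    (hQ : IsColumnProjection Z Q) :
    (riemannianGrad (psdManifold p r) f Z : Matrix (Fin p) (Fin p) ℝ) =
      gradient f Z - (1 - Q) * gradient f Z * (1 - Q) := by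
  set G := gradient f Z with hG
  have hR : (1 - Q)ᵀ = 1 - Q := by rw [Matrix.transpose_sub, hQ.symm, Matrix.transpose_one]
  have hRR : (1 - Q) * (1 - Q) = 1 - Q := by
    have := hQ.mul_proj
    simp [Matrix.sub_mul, Matrix.mul_sub, this]
  have hGs : Gᵀ = G := gradient_transpose hfsymm hd (isSymm_of_mem_psdManifold hZ)
  have hmem : G - (1 - Q) * G * (1 - Q) ∈ tangentSpaceAt (psdManifold p r) Z := by
    rw [mem_tangentSpaceAt_iff hZ hQ]
    constructor
    · rw [Matrix.transpose_sub, Matrix.transpose_mul, Matrix.transpose_mul, hR, hGs,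
        Matrix.mul_assoc]
    · generalize 1 - Q = R at hRR ⊢
      rw [Matrix.mul_sub, Matrix.sub_mul, ← Matrix.mul_assoc, ← Matrix.mul_assoc, hRR,
        Matrix.mul_assoc _ R R, hRR, sub_self]
  suffices h : riemannianGrad (psdManifold p r) f Z = ⟨_, hmem⟩ by rw [h]
  refine ext_inner_right ℝ fun v => ?_
  have hv := ((mem_tangentSpaceAt_iff hZ hQ).1 v.2).2
  have h0 : inner ℝ ((1 - Q) * G * (1 - Q)) (v : Matrix (Fin p) (Fin p) ℝ) = 0 := by
    rw [real_inner_comm, matrix_inner_mul_left, hR, matrix_inner_mul_right, hR, ← Matrix.mul_assoc,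
      hv, inner_zero_left]
  rw [riemannianGrad, InnerProductSpace.toDual_symm_apply, Submodule.coe_inner]
  simp only [ContinuousLinearMap.comp_apply, Submodule.subtypeL_apply]
  rw [fderiv_eq_inner_gradient, inner_sub_left, h0, sub_zero]

theorem gradient_factorized {f : Matrix (Fin p) (Fin p) ℝ → ℝ} (hfsymm : ∀ Z, f Z = f Zᵀ)
    (hd : Differentiable ℝ f) (Y : Matrix (Fin p) (Fin r) ℝ) :
    gradient (factorized r f) Y = (2 : ℝ) • (gradient f (Y * Yᵀ) * Y) := by
  have hGs := gradient_transpose hfsymm (hd (Y * Yᵀ)) (by simp [Matrix.transpose_mul])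
  have hg : DifferentiableAt ℝ (factorized r f) Y :=
    (hd _).comp Y (ContDiff.matrix_mul_transpose.differentiable (n := 1) one_ne_zero Y)
  refine ext_inner_right ℝ fun B => ?_
  have h1 : HasDerivAt (fun t : ℝ => factorized r f (Y + t • B))
      (fderiv ℝ (factorized r f) Y B) 0 :=
    hg.hasFDerivAt.comp_hasDerivAt_of_eq 0 (hasDerivAt_add_smul Y B) (by simp)
  have h2 : HasDerivAt (fun t : ℝ => factorized r f (Y + t • B))
      (fderiv ℝ f (Y * Yᵀ) (Y * Bᵀ + B * Yᵀ)) 0 := by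
    have h3 := (hasDerivAt_add_smul Y B).matrix_mul (hasDerivAt_add_smul Y B).matrix_transpose
    have h4 := (hd (Y * Yᵀ)).hasFDerivAt.comp_hasDerivAt_of_eq 0 h3 (by simp)
    rw [zero_smul, add_zero] at h4
    exact h4
  rw [← fderiv_eq_inner_gradient, h1.unique h2, fderiv_eq_inner_gradient, inner_add_right,
    inner_smul_left]
  have h5 : inner ℝ (gradient f (Y * Yᵀ)) (B * Yᵀ) = inner ℝ (gradient f (Y * Yᵀ) * Y) B := by
    rw [matrix_inner_mul_left, Matrix.transpose_transpose]
  have h6 : inner ℝ (gradient f (Y * Yᵀ)) (Y * Bᵀ) = inner ℝ (gradient f (Y * Yᵀ) * Y) B := by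
    rw [← h5, ← matrix_inner_transpose, hGs, Matrix.transpose_mul, Matrix.transpose_transpose]
  rw [h5, h6]
  simp
  ring

end Gradient

/-! ### Projections onto column spaces -/

section ColumnProjection

variable {p r : ℕ}

theorem mul_transpose_mem_psdManifold {Y : Matrix (Fin p) (Fin r) ℝ} (hY : Y.rank = r) :
    Y * Yᵀ ∈ psdManifold p r :=
  ⟨Matrix.posSemidef_self_mul_conjTranspose Y, by rw [Matrix.rank_self_mul_transpose, hY]⟩

theorem det_transpose_mul_self_ne_zero_iff {Y : Matrix (Fin p) (Fin r) ℝ} :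
    (Yᵀ * Y).det ≠ 0 ↔ Y.rank = r := by
  rw [← Matrix.rank_transpose_mul_self, ← isUnit_iff_ne_zero, ← Matrix.isUnit_iff_isUnit_det]
  constructor
  · intro h
    simpa using Matrix.rank_of_isUnit _ h
  · intro h
    rw [← Matrix.mulVec_surjective_iff_isUnit, ← Matrix.coe_mulVecLin, ← LinearMap.range_eq_top]
    apply Submodule.eq_top_of_finrank_eq
    simpa [Matrix.rank] using h

theorem isColumnProjection_mul_moorePenrose (Y : Matrix (Fin p) (Fin r) ℝ) :
    IsColumnProjection (Y * Yᵀ) (Y * moorePenrose Y) := by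
  have h := moorePenrose_spec Y
  refine ⟨h.symm_left, by rw [← Matrix.mul_assoc, h.mul_mul_left],
    (moorePenrose Y)ᵀ * moorePenrose Y, ?_⟩
  calc Y * moorePenrose Y = Y * (moorePenrose Y * Y)ᵀ * moorePenrose Y := by
        rw [h.symm_right, ← Matrix.mul_assoc, h.mul_mul_left]
    _ = _ := by simp only [Matrix.transpose_mul, Matrix.mul_assoc]

/-- Near `Y Yᵀ` the columns of `Z Y` span the column space of `Z`, which gives a formula for the
projection that is differentiable in `Z`. -/
theorem isColumnProjection_of_det_ne_zero {Z : Matrix (Fin p) (Fin p) ℝ} (hZ : Z ∈ psdManifold p r)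
    {Y W : Matrix (Fin p) (Fin r) ℝ} (hW : W = Z * Y) (hdet : (Wᵀ * W).det ≠ 0) :
    IsColumnProjection Z (W * (Wᵀ * W)⁻¹ * Wᵀ) := by
  refine ⟨by simp [Matrix.transpose_mul, Matrix.transpose_nonsing_inv, Matrix.mul_assoc], ?_,
    Y * (Wᵀ * W)⁻¹ * Wᵀ, by rw [hW]; simp only [Matrix.mul_assoc]⟩
  have hrange : LinearMap.range W.mulVecLin = LinearMap.range Z.mulVecLin := by
    apply Submodule.eq_of_le_of_finrank_eq
    · rw [hW, Matrix.mulVecLin_mul]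
      exact LinearMap.range_comp_le_range _ _
    · change W.rank = Z.rank
      rw [hZ.2, det_transpose_mul_self_ne_zero_iff.1 hdet]
  have hcol : ∀ j, ∃ v, W *ᵥ v = Z.col j := fun j => by
    have : Z *ᵥ Pi.single j 1 ∈ LinearMap.range W.mulVecLin := by
      rw [hrange]; exact ⟨_, rfl⟩
    simpa using this
  choose L hL using hcol
  have hWL : Z = W * (Matrix.of L)ᵀ := by
    ext i j
    exact (congrFun (hL j) i).symm
  calc W * (Wᵀ * W)⁻¹ * Wᵀ * Z = W * ((Wᵀ * W)⁻¹ * (Wᵀ * W)) * (Matrix.of L)ᵀ := by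
        rw [hWL]; simp only [Matrix.mul_assoc]
    _ = Z := by rw [Matrix.nonsing_inv_mul _ hdet.isUnit, Matrix.mul_one, ← hWL]

end ColumnProjection

/-! ### The Riemannian Hessian -/

section Hessian

/-- The Riesz isomorphism as a real linear map. -/
noncomputable def rieszCLM (E : Type*) [NormedAddCommGroup E] [InnerProductSpace ℝ E]
    [FiniteDimensional ℝ E] : (E →L[ℝ] ℝ) →L[ℝ] E :=
  LinearMap.toContinuousLinearMap
    { toFun := (InnerProductSpace.toDual ℝ E).symm
      map_add' := map_add _
      map_smul' := fun c φ => by simp }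

section Euclidean

variable {E : Type*} [NormedAddCommGroup E] [InnerProductSpace ℝ E] [FiniteDimensional ℝ E]

theorem ContDiff.differentiable_gradient {g : E → ℝ} (hg : ContDiff ℝ 2 g) :
    Differentiable ℝ (gradient g) :=
  (rieszCLM E).differentiable.comp ((hg.fderiv_right (m := 1) le_rfl).differentiable one_ne_zero)

theorem inner_euclideanHessian_comm {g : E → ℝ} (hg : ContDiff ℝ 2 g) (y a b : E) :
    inner ℝ (euclideanHessian g y a) b = inner ℝ a (euclideanHessian g y b) := by
  have hd : DifferentiableAt ℝ (fderiv ℝ g) y :=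
    (hg.fderiv_right (m := 1) le_rfl).differentiable one_ne_zero y
  have h : euclideanHessian g y = (rieszCLM E).comp (fderiv ℝ (fderiv ℝ g) y) :=
    ((rieszCLM E).hasFDerivAt.comp y hd.hasFDerivAt).fderiv
  have h2 : ∀ a b, inner ℝ (euclideanHessian g y a) b = fderiv ℝ (fderiv ℝ g) y a b := by
    intro a b
    rw [h]
    exact InnerProductSpace.toDual_symm_apply
  rw [h2, real_inner_comm, h2]
  exact (hg.contDiffAt.isSymmSndFDerivAt (by simp)) a b

end Euclidean

variable {p r : ℕ}

theorem riemannianGrad_differentiableAt {f : Matrix (Fin p) (Fin p) ℝ → ℝ} (hf : ContDiff ℝ 2 f)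
    (hfsymm : ∀ Z, f Z = f Zᵀ) {Y : Matrix (Fin p) (Fin r) ℝ} (hY : Y.rank = r) :
    RiemannianGradDifferentiableAt (psdManifold p r) f (Y * Yᵀ) := by
  let W : Matrix (Fin p) (Fin p) ℝ → Matrix (Fin p) (Fin r) ℝ := fun Z => Z * Y
  let Q : Matrix (Fin p) (Fin p) ℝ → Matrix (Fin p) (Fin p) ℝ :=
    fun Z => W Z * ((W Z)ᵀ * W Z)⁻¹ * (W Z)ᵀ
  have hdet : ((W (Y * Yᵀ))ᵀ * W (Y * Yᵀ)).det ≠ 0 := by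
    have h := det_transpose_mul_self_ne_zero_iff.2 hY
    have : (W (Y * Yᵀ))ᵀ * W (Y * Yᵀ) = (Yᵀ * Y) * (Yᵀ * Y) * (Yᵀ * Y) := by
      simp [W, Matrix.transpose_mul, Matrix.mul_assoc]
    rw [this]
    simp only [Matrix.det_mul] at h ⊢
    exact mul_ne_zero (mul_ne_zero h h) h
  have hW : DifferentiableAt ℝ W (Y * Yᵀ) :=
    differentiableAt_id.matrix_mul (differentiableAt_const Y)
  have hWW := hW.matrix_transpose.matrix_mul hW
  have hQ : DifferentiableAt ℝ Q (Y * Yᵀ) :=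
    (hW.matrix_mul (hWW.matrix_inv hdet)).matrix_mul hW.matrix_transpose
  have hR := (differentiableAt_const (1 : Matrix (Fin p) (Fin p) ℝ)).sub hQ
  have hG : DifferentiableAt ℝ (gradient f) (Y * Yᵀ) := hf.differentiable_gradient _
  have hH := hG.sub ((hR.matrix_mul hG).matrix_mul hR)
  have heq : ∀ Z ∈ psdManifold p r, ((W Z)ᵀ * W Z).det ≠ 0 →
      (riemannianGrad (psdManifold p r) f Z : Matrix (Fin p) (Fin p) ℝ) =
        gradient f Z - (1 - Q Z) * gradient f Z * (1 - Q Z) := fun Z hZ hd =>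
    riemannianGrad_eq hfsymm (hf.differentiable two_ne_zero Z) hZ
      (isColumnProjection_of_det_ne_zero hZ rfl hd)
  refine hH.differentiableWithinAt.congr_of_eventuallyEq ?_
    (heq _ (mul_transpose_mem_psdManifold hY) hdet)
  have hcont : ContinuousAt (fun Z => ((W Z)ᵀ * W Z).det) (Y * Yᵀ) :=
    (Continuous.matrix_det continuous_id).continuousAt.comp hWW.continuousAt
  filter_upwards [self_mem_nhdsWithin, nhdsWithin_le_nhds (hcont.eventually_ne hdet)] with Z hZ hd
  exact heq Z hZ hd

theorem riemannianGrad_mul_transpose {f : Matrix (Fin p) (Fin p) ℝ → ℝ} (hf : Differentiable ℝ f)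
    (hfsymm : ∀ Z, f Z = f Zᵀ) {Y : Matrix (Fin p) (Fin r) ℝ} (hY : Y.rank = r) :
    (riemannianGrad (psdManifold p r) f (Y * Yᵀ) : Matrix (Fin p) (Fin p) ℝ) =
      (1 / 2 : ℝ) • (gradient (factorized r f) Y * moorePenrose Y +
        (gradient (factorized r f) Y * moorePenrose Y)ᵀ * (1 - Y * moorePenrose Y)) := by
  have hQ := isColumnProjection_mul_moorePenrose Y
  have hGs := gradient_transpose hfsymm (hf (Y * Yᵀ)) (by simp [Matrix.transpose_mul])
  rw [riemannianGrad_eq hfsymm (hf _) (mul_transpose_mem_psdManifold hY) hQ,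
    gradient_factorized hfsymm hf, Matrix.smul_mul, Matrix.transpose_smul, Matrix.smul_mul,
    ← smul_add, smul_smul, Matrix.mul_assoc _ Y, Matrix.transpose_mul, hQ.symm, hGs]
  norm_num
  noncomm_ring

theorem gradient_factorized_eq_riemannianGrad {f : Matrix (Fin p) (Fin p) ℝ → ℝ}
    (hf : Differentiable ℝ f) (hfsymm : ∀ Z, f Z = f Zᵀ) {Y : Matrix (Fin p) (Fin r) ℝ}
    (hY : Y.rank = r) :
    gradient (factorized r f) Y =
      (2 : ℝ) • ((riemannianGrad (psdManifold p r) f (Y * Yᵀ) : Matrix (Fin p) (Fin p) ℝ) * Y) := by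
  have hRY : (1 - Y * moorePenrose Y) * Y = 0 := by
    rw [Matrix.sub_mul, (moorePenrose_spec Y).mul_mul_left, Matrix.one_mul, sub_self]
  rw [riemannianGrad_eq hfsymm (hf _) (mul_transpose_mem_psdManifold hY)
    (isColumnProjection_mul_moorePenrose Y), gradient_factorized hfsymm hf, Matrix.sub_mul,
    Matrix.mul_assoc _ (1 - Y * moorePenrose Y) Y, hRY, Matrix.mul_zero, sub_zero]

/-- The derivative `A ↦ A Yᵀ + Y Aᵀ` of the parametrization `Y ↦ Y Yᵀ`. -/
def factorDerivative (Y : Matrix (Fin p) (Fin r) ℝ) :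
    Matrix (Fin p) (Fin r) ℝ →ₗ[ℝ] Matrix (Fin p) (Fin p) ℝ where
  toFun A := A * Yᵀ + Y * Aᵀ
  map_add' A B := by simp only [Matrix.add_mul, Matrix.transpose_add, Matrix.mul_add]; abel
  map_smul' c A := by simp

theorem factorDerivative_apply (Y A : Matrix (Fin p) (Fin r) ℝ) :
    factorDerivative Y A = A * Yᵀ + Y * Aᵀ := rfl

theorem range_factorDerivative {Y : Matrix (Fin p) (Fin r) ℝ} (hY : Y.rank = r) :
    LinearMap.range (factorDerivative Y) = tangentSpaceAt (psdManifold p r) (Y * Yᵀ) := by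
  have hQ := isColumnProjection_mul_moorePenrose Y
  have hMP := moorePenrose_spec Y
  have hM := mul_transpose_mem_psdManifold hY
  have hRY : (1 - Y * moorePenrose Y) * Y = 0 := by
    rw [Matrix.sub_mul, hMP.mul_mul_left, Matrix.one_mul, sub_self]
  have hYR : Yᵀ * (1 - Y * moorePenrose Y) = 0 := by
    have := congrArg Matrix.transpose hRY
    rwa [Matrix.transpose_mul, Matrix.transpose_sub, hQ.symm, Matrix.transpose_one,
      Matrix.transpose_zero] at this
  ext v
  rw [mem_tangentSpaceAt_iff hM hQ]
  constructor
  · rintro ⟨A, rfl⟩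
    rw [factorDerivative_apply]
    refine ⟨by simp [Matrix.transpose_mul, add_comm], ?_⟩
    rw [Matrix.mul_add, ← Matrix.mul_assoc _ Y, hRY, Matrix.zero_mul, add_zero, Matrix.mul_assoc,
      Matrix.mul_assoc, hYR, Matrix.mul_zero, Matrix.mul_zero]
  · rintro ⟨hs, hv⟩
    set Q := Y * moorePenrose Y with hQdef
    -- `v = Qv + vQ - QvQ`; the term `QvQ` is shared evenly between `A Yᵀ` and its transpose.
    have hAY : (v - (1 / 2 : ℝ) • (Q * v)) * (moorePenrose Y)ᵀ * Yᵀ =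
        v * Q - (1 / 2 : ℝ) • (Q * v * Q) := by
      rw [Matrix.mul_assoc, ← Matrix.transpose_mul, ← hQdef, hQ.symm, Matrix.sub_mul,
        Matrix.smul_mul]
    refine ⟨(v - (1 / 2 : ℝ) • (Q * v)) * (moorePenrose Y)ᵀ, ?_⟩
    rw [factorDerivative_apply]
    have hYA := congrArg Matrix.transpose hAY
    rw [Matrix.transpose_mul, Matrix.transpose_transpose] at hYA
    rw [hAY, hYA]
    simp only [Matrix.transpose_sub, Matrix.transpose_mul, Matrix.transpose_smul, hQ.symm, hs]
    have h : v - v * Q - Q * v + Q * v * Q = 0 := by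
      rw [← hv]; noncomm_ring
    have h2 : v * Q - (1 / 2 : ℝ) • (Q * v * Q) + (Q * v - (1 / 2 : ℝ) • (Q * (v * Q))) =
        v * Q + Q * v - Q * v * Q := by rw [← Matrix.mul_assoc Q v Q]; module
    rw [h2, eq_comm, ← sub_eq_zero, ← h]
    abel

theorem factorDerivative_mem {Y : Matrix (Fin p) (Fin r) ℝ} (hY : Y.rank = r)
    (A : Matrix (Fin p) (Fin r) ℝ) :
    factorDerivative Y A ∈ tangentSpaceAt (psdManifold p r) (Y * Yᵀ) := by
  rw [← range_factorDerivative hY]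
  exact ⟨A, rfl⟩

/-- At a stationary point, differentiating `∇g(Y) = 2 grad f(Y Yᵀ) Y` along `Y + tA` leaves only
the term in which `grad f` is differentiated. -/
theorem euclideanHessian_apply {f : Matrix (Fin p) (Fin p) ℝ → ℝ} (hf : ContDiff ℝ 2 f)
    (hfsymm : ∀ Z, f Z = f Zᵀ) {Y : Matrix (Fin p) (Fin r) ℝ} (hY : Y.rank = r)
    (hg0 : gradient (factorized r f) Y = 0) (A : Matrix (Fin p) (Fin r) ℝ) :
    ∃ V : Matrix (Fin p) (Fin p) ℝ, Vᵀ = V ∧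
      V = fderivWithin ℝ (fun z => (riemannianGrad (psdManifold p r) f z :
        Matrix (Fin p) (Fin p) ℝ)) (psdManifold p r) (Y * Yᵀ) (factorDerivative Y A) ∧
      euclideanHessian (factorized r f) Y A = (2 : ℝ) • (V * Y) := by
  set F : Matrix (Fin p) (Fin p) ℝ → Matrix (Fin p) (Fin p) ℝ :=
    fun z => (riemannianGrad (psdManifold p r) f z : Matrix (Fin p) (Fin p) ℝ) with hF
  have hfd := hf.differentiable two_ne_zero
  have hF0 : F (Y * Yᵀ) = 0 := by
    simp [hF, riemannianGrad_mul_transpose hfd hfsymm hY, hg0]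
  have hline := hasDerivAt_add_smul Y A
  have hcurve : HasDerivAt (fun t : ℝ => (Y + t • A) * (Y + t • A)ᵀ) (factorDerivative Y A) 0 := by
    have h := hline.matrix_mul hline.matrix_transpose
    rw [zero_smul, add_zero, add_comm] at h
    exact h
  have hrank : ∀ᶠ t : ℝ in 𝓝 0, (Y + t • A).rank = r := by
    have hc : ContinuousAt (fun t : ℝ => ((Y + t • A)ᵀ * (Y + t • A)).det) 0 :=
      (Continuous.matrix_det continuous_id).continuousAt.comp
        (hline.matrix_transpose.matrix_mul hline).continuousAt
    have h0 : ((Y + (0 : ℝ) • A)ᵀ * (Y + (0 : ℝ) • A)).det ≠ 0 := by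
      rw [zero_smul, add_zero]
      exact det_transpose_mul_self_ne_zero_iff.2 hY
    filter_upwards [hc.eventually_ne h0] with t ht
    exact det_transpose_mul_self_ne_zero_iff.1 ht
  have hFd : HasDerivAt (fun t : ℝ => F ((Y + t • A) * (Y + t • A)ᵀ))
      (fderivWithin ℝ F (psdManifold p r) (Y * Yᵀ) (factorDerivative Y A)) 0 := by
    have hw : HasFDerivWithinAt F (fderivWithin ℝ F (psdManifold p r) (Y * Yᵀ)) (psdManifold p r)
        (Y * Yᵀ) := (riemannianGrad_differentiableAt hf hfsymm hY).hasFDerivWithinAt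
    have hS : {t : ℝ | (Y + t • A).rank = r} ∈ 𝓝 (0 : ℝ) := hrank
    have h := hw.comp_hasDerivWithinAt_of_eq (s := {t : ℝ | (Y + t • A).rank = r}) 0
      hcurve.hasDerivWithinAt (fun t ht => mul_transpose_mem_psdManifold ht) (by simp)
    exact h.hasDerivAt hS
  refine ⟨_, ?_, rfl, ?_⟩
  · refine (hFd.matrix_transpose.congr_of_eventuallyEq ?_).unique hFd
    refine Filter.Eventually.of_forall fun t => ?_
    exact (tangentSpaceAt_le_symm (riemannianGrad (psdManifold p r) f _).2).symm
  · have hg : ContDiff ℝ 2 (factorized r f) := hf.comp ContDiff.matrix_mul_transpose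
    have h1 : HasDerivAt (fun t : ℝ => gradient (factorized r f) (Y + t • A))
        (euclideanHessian (factorized r f) Y A) 0 :=
      (hg.differentiable_gradient Y).hasFDerivAt.comp_hasDerivAt_of_eq 0 hline (by simp)
    have h2 := (hFd.matrix_mul hline).const_smul (2 : ℝ)
    -- the product rule term `grad f(Y Yᵀ) A` vanishes by stationarity
    rw [zero_smul, add_zero, hF0, Matrix.zero_mul, zero_add] at h2
    refine h1.unique (h2.congr_of_eventuallyEq ?_)
    filter_upwards [hrank] with t ht
    exact gradient_factorized_eq_riemannianGrad hfd hfsymm ht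

/-- At a stationary point the Euclidean Hessian form is the pullback of the Riemannian one. -/
theorem inner_euclideanHessian_eq_riemannianHess {f : Matrix (Fin p) (Fin p) ℝ → ℝ}
    (hf : ContDiff ℝ 2 f) (hfsymm : ∀ Z, f Z = f Zᵀ) {Y : Matrix (Fin p) (Fin r) ℝ}
    (hY : Y.rank = r) (hg0 : gradient (factorized r f) Y = 0) (A B : Matrix (Fin p) (Fin r) ℝ) :
    inner ℝ (euclideanHessian (factorized r f) Y A) B =
      inner ℝ (riemannianHess (psdManifold p r) f (Y * Yᵀ)
        ⟨factorDerivative Y A, factorDerivative_mem hY A⟩)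
        ⟨factorDerivative Y B, factorDerivative_mem hY B⟩ := by
  obtain ⟨V, hVs, hV, hH⟩ := euclideanHessian_apply hf hfsymm hY hg0 A
  have h1 : inner ℝ V (B * Yᵀ) = inner ℝ (V * Y) B := by
    rw [matrix_inner_mul_left, Matrix.transpose_transpose]
  have h2 : inner ℝ V (Y * Bᵀ) = inner ℝ (V * Y) B := by
    rw [← h1, ← matrix_inner_transpose, hVs, Matrix.transpose_mul, Matrix.transpose_transpose]
  have h3 : riemannianHess (psdManifold p r) f (Y * Yᵀ)
      ⟨factorDerivative Y A, factorDerivative_mem hY A⟩ =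
      (tangentSpaceAt (psdManifold p r) (Y * Yᵀ)).orthogonalProjectionOnto V := by
    rw [hV]; rfl
  rw [h3, Submodule.inner_orthogonalProjectionOnto_eq_of_mem_right, hH]
  change _ = inner ℝ V (B * Yᵀ + Y * Bᵀ)
  rw [inner_add_right, h1, h2, inner_smul_left]
  simp
  ring

end Hessian

/-! ### The kernel of the parametrization and its orthogonal complement -/

section Kernel

/-- The space of skew-symmetric `r × r` real matrices. -/
def skewMatrices (r : ℕ) : Submodule ℝ (Matrix (Fin r) (Fin r) ℝ) where
  carrier := {T | T + Tᵀ = 0}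
  zero_mem' := by simp
  add_mem' {S T} hS hT := by
    change S + T + (S + T)ᵀ = 0
    have hS' : S + Sᵀ = 0 := hS
    have hT' : T + Tᵀ = 0 := hT
    rw [Matrix.transpose_add, add_add_add_comm, hS', hT', add_zero]
  smul_mem' c T hT := by
    change c • T + (c • T)ᵀ = 0
    have hT' : T + Tᵀ = 0 := hT
    rw [Matrix.transpose_smul, ← smul_add, hT', smul_zero]

theorem mem_skewMatrices {r : ℕ} {T : Matrix (Fin r) (Fin r) ℝ} :
    T ∈ skewMatrices r ↔ T + Tᵀ = 0 := Iff.rfl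

/-- The entries above the diagonal are coordinates on the skew-symmetric matrices. -/
theorem finrank_skewMatrices (r : ℕ) :
    Module.finrank ℝ (skewMatrices r) = (r ^ 2 - r) / 2 := by
  let e : skewMatrices r ≃ₗ[ℝ] ((Σ j : Fin r, Fin j) → ℝ) :=
    { toFun := fun T x => (T : Matrix (Fin r) (Fin r) ℝ) (Fin.castLE x.1.2.le x.2) x.1
      map_add' := fun S T => rfl
      map_smul' := fun c T => rfl
      invFun := fun a => ⟨Matrix.of fun i j =>
        if h : i < j then a ⟨j, ⟨i, h⟩⟩ else if h : j < i then -a ⟨i, ⟨j, h⟩⟩ else 0, by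
          rw [mem_skewMatrices]
          ext i j
          rcases lt_trichotomy i j with h | h | h
          · simp [h, h.not_gt]
          · simp [h]
          · simp [h, h.not_gt]⟩
      left_inv := fun T => by
        have hT : ∀ i j, (T : Matrix (Fin r) (Fin r) ℝ) i j = -T.1 j i := fun i j =>
          eq_neg_of_add_eq_zero_left (congrFun (congrFun (mem_skewMatrices.1 T.2) i) j)
        ext i j
        rcases lt_trichotomy i j with h | h | h
        · simp [h]
        · subst h
          have := hT i i
          simp
          linarith
        · simp [h, h.not_gt, hT i j]
      right_inv := fun a => by
        funext x
        have h : Fin.castLE x.1.2.le x.2 < x.1 := x.2.2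
        simp [h] }
  rw [e.finrank_eq, Module.finrank_fintype_fun_eq_card, Fintype.card_sigma]
  simp only [Fintype.card_fin]
  rw [Fin.sum_univ_eq_sum_range (fun i => i), Finset.sum_range_id, Nat.mul_sub_one, sq]

variable {p r : ℕ}

theorem mul_left_cancel_of_rank {n : Type*} {Y : Matrix (Fin p) (Fin r) ℝ} (hY : Y.rank = r)
    {S T : Matrix (Fin r) n ℝ} (h : Y * S = Y * T) : S = T := by
  have hN := (det_transpose_mul_self_ne_zero_iff.2 hY).isUnit
  have h1 : (Yᵀ * Y)⁻¹ * (Yᵀ * Y) * S = (Yᵀ * Y)⁻¹ * (Yᵀ * Y) * T := by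
    simp only [Matrix.mul_assoc, h]
  simpa [Matrix.nonsing_inv_mul _ hN] using h1

theorem mem_ker_factorDerivative {Y : Matrix (Fin p) (Fin r) ℝ} (hY : Y.rank = r)
    {A : Matrix (Fin p) (Fin r) ℝ} :
    A ∈ LinearMap.ker (factorDerivative Y) ↔ ∃ T ∈ skewMatrices r, A = Y * T := by
  rw [LinearMap.mem_ker, factorDerivative_apply]
  constructor
  · intro h
    have hN := (det_transpose_mul_self_ne_zero_iff.2 hY).isUnit
    have hA : A = Y * (-(Aᵀ * Y) * (Yᵀ * Y)⁻¹) := by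
      have h1 : A * (Yᵀ * Y) = Y * -(Aᵀ * Y) := by
        rw [← Matrix.mul_assoc, eq_neg_of_add_eq_zero_left h, Matrix.neg_mul, Matrix.mul_neg,
          Matrix.mul_assoc]
      rw [← Matrix.mul_assoc, ← h1, Matrix.mul_assoc, Matrix.mul_nonsing_inv _ hN, Matrix.mul_one]
    refine ⟨_, ?_, hA⟩
    set T := -(Aᵀ * Y) * (Yᵀ * Y)⁻¹
    have h2 : Y * ((T + Tᵀ) * Yᵀ) = Y * (0 : Matrix (Fin r) (Fin p) ℝ) := by
      rw [Matrix.mul_zero, ← h, hA]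
      simp only [Matrix.add_mul, Matrix.mul_add, Matrix.transpose_mul, Matrix.mul_assoc]
    have h3 := congrArg Matrix.transpose (mul_left_cancel_of_rank hY h2)
    rw [Matrix.transpose_mul, Matrix.transpose_transpose, Matrix.transpose_zero,
      ← Matrix.mul_zero Y, Matrix.transpose_add, Matrix.transpose_transpose, add_comm] at h3
    exact mul_left_cancel_of_rank hY h3
  · rintro ⟨T, hT, rfl⟩
    rw [Matrix.transpose_mul, ← Matrix.mul_assoc, ← Matrix.add_mul, ← Matrix.mul_add,
      mem_skewMatrices.1 hT, Matrix.mul_zero, Matrix.zero_mul]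

theorem finrank_ker_factorDerivative {Y : Matrix (Fin p) (Fin r) ℝ} (hY : Y.rank = r) :
    Module.finrank ℝ (LinearMap.ker (factorDerivative Y)) = (r ^ 2 - r) / 2 := by
  let φ : Matrix (Fin r) (Fin r) ℝ →ₗ[ℝ] Matrix (Fin p) (Fin r) ℝ :=
    { toFun := fun T => Y * T
      map_add' := Matrix.mul_add Y
      map_smul' := fun c T => Matrix.mul_smul Y c T }
  have hφ : Function.Injective φ := fun S T h => mul_left_cancel_of_rank hY h
  have : LinearMap.ker (factorDerivative Y) = (skewMatrices r).map φ := by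
    ext A
    rw [mem_ker_factorDerivative hY, Submodule.mem_map]
    exact exists_congr fun T => and_congr_right fun _ => eq_comm
  rw [this, ← (Submodule.equivMapOfInjective φ hφ _).finrank_eq, finrank_skewMatrices]

theorem mem_ker_factorDerivative_orthogonal {Y : Matrix (Fin p) (Fin r) ℝ} (hY : Y.rank = r)
    {A : Matrix (Fin p) (Fin r) ℝ} :
    A ∈ (LinearMap.ker (factorDerivative Y))ᗮ ↔ (Yᵀ * A)ᵀ = Yᵀ * A := by
  have key : ∀ T : Matrix (Fin r) (Fin r) ℝ, inner ℝ (Y * T) A = inner ℝ T (Yᵀ * A) := fun T => by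
    rw [matrix_inner_mul_right, Matrix.transpose_transpose]
  rw [Submodule.mem_orthogonal]
  constructor
  · intro h
    set S := Yᵀ * A with hS
    have h1 : inner ℝ (S - Sᵀ) S = 0 := by
      rw [← key]
      refine h _ ((mem_ker_factorDerivative hY).2 ⟨_, ?_, rfl⟩)
      simp [mem_skewMatrices]
    have h2 : inner ℝ (S - Sᵀ) Sᵀ = 0 := by
      rw [← matrix_inner_transpose, Matrix.transpose_sub, Matrix.transpose_transpose, ← neg_sub,
        inner_neg_left, h1, neg_zero]
    have h3 : S - Sᵀ = 0 := by
      rw [← inner_self_eq_zero (𝕜 := ℝ), inner_sub_right, h1, h2, sub_zero]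
    exact (sub_eq_zero.1 h3).symm
  · intro h B hB
    obtain ⟨T, hT, rfl⟩ := (mem_ker_factorDerivative hY).1 hB
    have h1 := matrix_inner_transpose T (Yᵀ * A)
    rw [h, eq_neg_of_add_eq_zero_right (mem_skewMatrices.1 hT), inner_neg_left] at h1
    rw [key]
    linarith

/-- The parametrization derivative identifies the orthogonal complement of its kernel with the
tangent space. -/
noncomputable def horizontalEquiv {Y : Matrix (Fin p) (Fin r) ℝ} (hY : Y.rank = r) :
    ((LinearMap.ker (factorDerivative Y))ᗮ : Submodule ℝ (Matrix (Fin p) (Fin r) ℝ)) ≃ₗ[ℝ]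
      tangentSpaceAt (psdManifold p r) (Y * Yᵀ) :=
  LinearEquiv.ofBijective
    (((factorDerivative Y).codRestrict _ (factorDerivative_mem hY)).domRestrict _) (by
      constructor
      · rw [← LinearMap.ker_eq_bot, LinearMap.ker_eq_bot']
        intro A hA
        have h1 : (A : Matrix (Fin p) (Fin r) ℝ) ∈ LinearMap.ker (factorDerivative Y) :=
          congrArg Subtype.val hA
        have h2 := inner_self_eq_zero (𝕜 := ℝ).1 (A.2 _ h1)
        exact Subtype.ext h2
      · rintro ⟨v, hv⟩
        rw [← range_factorDerivative hY] at hv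
        obtain ⟨A, rfl⟩ := hv
        obtain ⟨k, hk, a, ha, rfl⟩ :=
          (LinearMap.ker (factorDerivative Y)).exists_add_mem_mem_orthogonal A
        refine ⟨⟨a, ha⟩, Subtype.ext ?_⟩
        change factorDerivative Y a = factorDerivative Y (k + a)
        rw [map_add, LinearMap.mem_ker.1 hk, zero_add])

theorem finrank_tangentSpaceAt {Y : Matrix (Fin p) (Fin r) ℝ} (hY : Y.rank = r) :
    Module.finrank ℝ (tangentSpaceAt (psdManifold p r) (Y * Yᵀ)) = p * r - (r ^ 2 - r) / 2 := by
  have h := (factorDerivative Y).finrank_range_add_finrank_ker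
  rw [finrank_ker_factorDerivative hY, range_factorDerivative hY, Module.finrank_matrix] at h
  simp at h
  omega

end Kernel

/-! ### Singular value bounds on horizontal vectors -/

section Bounds

variable {p r : ℕ}

/-- A nonzero vector `a` with `YᵀY a = μ a` gives the eigenvector `Y a` of `Y Yᵀ`, whose `r`
positive singular values are its leading ones. -/
theorem eigenvalue_mem_Icc_sigma {Y : Matrix (Fin p) (Fin r) ℝ} (hY : Y.rank = r) {μ : ℝ}
    {a : Fin r → ℝ} (ha : a ≠ 0) (h : (Yᵀ * Y) *ᵥ a = μ • a) :
    μ ∈ Set.Icc (sigma r (Y * Yᵀ)) (sigma 1 (Y * Yᵀ)) := by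
  have hw : Y *ᵥ a ≠ 0 := by
    intro h0
    have h1 : (Yᵀ * Y) *ᵥ a = 0 := by rw [← Matrix.mulVec_mulVec, h0, Matrix.mulVec_zero]
    exact ha (Matrix.eq_zero_of_mulVec_eq_zero (det_transpose_mul_self_ne_zero_iff.2 hY) h1)
  -- `μ ‖a‖² = ‖Y a‖² > 0`
  have hpos : 0 < μ := by
    have h1 : (Y *ᵥ a) ⬝ᵥ (Y *ᵥ a) = μ * (a ⬝ᵥ a) := by
      rw [Matrix.dotProduct_mulVec, ← Matrix.mulVec_transpose, Matrix.mulVec_mulVec, h,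
        smul_dotProduct, smul_eq_mul]
    have h2 : 0 < (Y *ᵥ a) ⬝ᵥ (Y *ᵥ a) := by
      simpa using Matrix.dotProduct_star_self_pos_iff.2 hw
    have h3 : 0 < a ⬝ᵥ a := by
      simpa using Matrix.dotProduct_star_self_pos_iff.2 ha
    rw [h1] at h2
    exact pos_of_mul_pos_left h2 h3.le
  set T := Matrix.toEuclideanLin (Y * Yᵀ) with hT
  set w : EuclideanSpace ℝ (Fin p) := WithLp.toLp 2 (Y *ᵥ a) with hwdef
  have hTw : T w = μ • w := by
    have : (Y * Yᵀ) *ᵥ (Y *ᵥ a) = μ • (Y *ᵥ a) := by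
      rw [← Matrix.mulVec_mulVec, Matrix.mulVec_mulVec _ Yᵀ, h, Matrix.mulVec_smul]
    rw [hT, hwdef, ← WithLp.toLp_smul, ← this]
    exact Matrix.toLpLin_toLp 2 2 _ _
  have hadj : LinearMap.adjoint T = T := by
    rw [hT, ← Matrix.toEuclideanLin_conjTranspose_eq_adjoint]
    simp [Matrix.transpose_mul]
  have heig : Module.End.HasEigenvalue (LinearMap.adjoint T ∘ₗ T) (μ ^ 2) := by
    refine Module.End.hasEigenvalue_of_hasEigenvector (x := w) ⟨?_, by simpa [hwdef] using hw⟩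
    rw [Module.End.mem_eigenspace_iff, LinearMap.comp_apply, hadj, hTw, map_smul, hTw, smul_smul,
      sq]
  obtain ⟨i, hi⟩ := T.isSymmetric_adjoint_comp_self.exists_eigenvalues_eq rfl heig
  have hsv : T.singularValues i = μ := by
    rw [T.singularValues_fin rfl i,
      show T.isSymmetric_adjoint_comp_self.eigenvalues rfl i = μ ^ 2 from hi, Real.sqrt_sq hpos.le]
  have hir : (i : ℕ) < r := by
    have h1 := T.singularValues_pos_iff_lt_finrank_range.1 (hsv.symm ▸ hpos)
    have h2 : Module.finrank ℝ (LinearMap.range T) = r := by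
      rw [hT, Matrix.toEuclideanLin_eq_toLin_orthonormal, ← Matrix.rank_eq_finrank_range_toLin,
        Matrix.rank_self_mul_transpose, hY]
    omega
  rw [Set.mem_Icc, ← hsv]
  exact ⟨T.singularValues_antitone (by omega), T.singularValues_antitone (by omega)⟩

/-- The form `A ↦ ‖A Yᵀ‖²` belongs to the symmetric operator `A ↦ A YᵀY`, all of whose eigenvalues
are eigenvalues of `YᵀY`. -/
theorem norm_sq_mul_transpose_mem_Icc {Y : Matrix (Fin p) (Fin r) ℝ} (hY : Y.rank = r)
    (A : Matrix (Fin p) (Fin r) ℝ) :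
    ‖A * Yᵀ‖ ^ 2 ∈ Set.Icc (sigma r (Y * Yᵀ) * ‖A‖ ^ 2) (sigma 1 (Y * Yᵀ) * ‖A‖ ^ 2) := by
  let S : Matrix (Fin p) (Fin r) ℝ →ₗ[ℝ] Matrix (Fin p) (Fin r) ℝ :=
    { toFun := fun B => B * (Yᵀ * Y)
      map_add' := fun B C => Matrix.add_mul B C _
      map_smul' := fun c B => Matrix.smul_mul c B _ }
  have hinner : ∀ B C, inner ℝ (S B) C = inner ℝ (B * Yᵀ) (C * Yᵀ) := fun B C => by
    rw [matrix_inner_mul_left, Matrix.transpose_transpose, Matrix.mul_assoc]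
    rfl
  have hS : S.IsSymmetric := fun B C => by
    rw [hinner, real_inner_comm, ← hinner, real_inner_comm]
  have heig : ∀ j, hS.eigenvalues rfl j ∈ Set.Icc (sigma r (Y * Yᵀ)) (sigma 1 (Y * Yᵀ)) := by
    intro j
    obtain ⟨hB, hB0⟩ := hS.hasEigenvector_eigenvectorBasis rfl j
    rw [Module.End.mem_eigenspace_iff] at hB
    generalize hS.eigenvectorBasis rfl j = B at hB hB0
    obtain ⟨i, hi⟩ : ∃ i, B.row i ≠ 0 := by
      by_contra! hcon
      exact hB0 (by ext i k; exact congrFun (hcon i) k)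
    refine eigenvalue_mem_Icc_sigma hY hi ?_
    have hrow := congrFun hB i
    rw [← Matrix.vecMul_transpose]
    have ht : (Yᵀ * Y)ᵀ = Yᵀ * Y := by simp [Matrix.transpose_mul]
    rw [ht]
    exact hrow
  rw [← real_inner_self_eq_norm_sq (A * Yᵀ), ← hinner, hS.inner_apply_self_eq_sum rfl,
    ← (hS.eigenvectorBasis rfl).sum_sq_inner_right, Finset.mul_sum, Finset.mul_sum]
  exact ⟨Finset.sum_le_sum fun j _ => mul_le_mul_of_nonneg_right (heig j).1 (sq_nonneg _),
    Finset.sum_le_sum fun j _ => mul_le_mul_of_nonneg_right (heig j).2 (sq_nonneg _)⟩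

/-- If `YᵀA` is symmetric, then `‖A Yᵀ + Y Aᵀ‖² = 2 ‖A Yᵀ‖² + 2 ‖YᵀA‖²`, and the second term lies
between `0` and the first. -/
theorem norm_sq_factorDerivative_mem_Icc {Y : Matrix (Fin p) (Fin r) ℝ} (hY : Y.rank = r)
    {A : Matrix (Fin p) (Fin r) ℝ} (hA : (Yᵀ * A)ᵀ = Yᵀ * A) :
    ‖factorDerivative Y A‖ ^ 2 ∈
      Set.Icc (2 * sigma r (Y * Yᵀ) * ‖A‖ ^ 2) (4 * sigma 1 (Y * Yᵀ) * ‖A‖ ^ 2) := by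
  have hnorm : ‖Y * Aᵀ‖ = ‖A * Yᵀ‖ := by
    rw [← Matrix.frobenius_norm_transpose, Matrix.transpose_mul, Matrix.transpose_transpose]
  have hcross : inner ℝ (A * Yᵀ) (Y * Aᵀ) = ‖Yᵀ * A‖ ^ 2 := by
    rw [← real_inner_self_eq_norm_sq, matrix_inner_mul_right, ← Matrix.mul_assoc,
      ← matrix_inner_transpose, matrix_inner_def, matrix_inner_def]
    simp only [Matrix.transpose_mul, Matrix.transpose_transpose] at hA ⊢
    rw [Matrix.mul_assoc (Yᵀ * A), hA]
  have hsum : ‖factorDerivative Y A‖ ^ 2 = 2 * ‖A * Yᵀ‖ ^ 2 + 2 * ‖Yᵀ * A‖ ^ 2 := by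
    rw [factorDerivative_apply, norm_add_sq_real, hcross, hnorm]
    ring
  have hle : ‖Yᵀ * A‖ ^ 2 ≤ ‖A * Yᵀ‖ ^ 2 := by
    rw [← hcross, sq]
    nth_rewrite 2 [← hnorm]
    exact real_inner_le_norm _ _
  have h := norm_sq_mul_transpose_mem_Icc hY A
  rw [hsum]
  constructor
  · nlinarith [h.1, sq_nonneg ‖Yᵀ * A‖]
  · nlinarith [h.2]

end Bounds

/-! ### The subspaces attached to an eigendecomposition -/

namespace EigDecomp

variable {p r : ℕ} {X : Matrix (Fin p) (Fin p) ℝ} {Y : Matrix (Fin p) (Fin r) ℝ}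
  (D : EigDecomp X r)

theorem mul_transpose_add_mul_transpose (hr : r ≤ p) :
    D.U * D.Uᵀ + D.Uperp * D.Uperpᵀ = 1 := by
  have h : (Matrix.fromCols D.U D.Uperp)ᵀ * Matrix.fromCols D.U D.Uperp = 1 := by
    have h2 := congrArg Matrix.transpose D.orthogonal
    rw [Matrix.transpose_mul, Matrix.transpose_transpose, Matrix.transpose_zero] at h2
    rw [Matrix.transpose_fromCols, Matrix.fromRows_mul_fromCols, D.orthonormal_U,
      D.orthonormal_Uperp, D.orthogonal, h2, Matrix.fromBlocks_one]
  have h3 := (Matrix.mul_eq_one_comm_of_card_eq _ _ _ (by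
    rw [Fintype.card_sum, Fintype.card_fin, Fintype.card_fin, Fintype.card_fin]; omega)).1 h
  rwa [Matrix.transpose_fromCols, Matrix.fromCols_mul_fromRows] at h3

theorem U_mul_P (hX : X = Y * Yᵀ) (hY : Y.rank = r) : D.U * D.P Y = Y := by
  have h1 : (D.U * D.Uᵀ - 1) * (Y * Yᵀ) = 0 := by
    rw [Matrix.sub_mul, Matrix.one_mul, hX.symm.trans D.eq_mul]
    have : D.U * D.Uᵀ * (D.U * Matrix.diagonal D.d * D.Uᵀ) =
        D.U * (D.Uᵀ * D.U) * Matrix.diagonal D.d * D.Uᵀ := by simp only [Matrix.mul_assoc]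
    rw [this, D.orthonormal_U, Matrix.mul_one, sub_self]
  have h2 : Y * ((D.U * D.Uᵀ - 1) * Y)ᵀ = Y * (0 : Matrix (Fin r) (Fin p) ℝ) := by
    rw [Matrix.mul_zero, ← Matrix.transpose_zero, ← h1]
    simp only [Matrix.transpose_mul, Matrix.transpose_transpose, Matrix.mul_assoc]
  have h3 := congrArg Matrix.transpose (mul_left_cancel_of_rank hY h2)
  rw [Matrix.transpose_transpose, Matrix.transpose_zero, Matrix.sub_mul, Matrix.one_mul,
    Matrix.mul_assoc] at h3
  exact sub_eq_zero.1 h3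

theorem isUnit_det_P (hX : X = Y * Yᵀ) (hY : Y.rank = r) : IsUnit (D.P Y).det := by
  have h := det_transpose_mul_self_ne_zero_iff.2 hY
  have h1 : Yᵀ * Y = (D.P Y)ᵀ * D.P Y := by
    nth_rewrite 1 2 [← D.U_mul_P hX hY]
    rw [Matrix.transpose_mul, Matrix.mul_assoc, ← Matrix.mul_assoc D.Uᵀ, D.orthonormal_U,
      Matrix.one_mul]
  rw [h1, Matrix.det_mul] at h
  exact (right_ne_zero_of_mul h).isUnit

theorem P_mul_transpose (hX : X = Y * Yᵀ) : D.P Y * (D.P Y)ᵀ = Matrix.diagonal D.d := by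
  calc D.P Y * (D.P Y)ᵀ = D.Uᵀ * (Y * Yᵀ) * D.U := by
        simp [EigDecomp.P, Matrix.transpose_mul, Matrix.mul_assoc]
    _ = (D.Uᵀ * D.U) * Matrix.diagonal D.d * (D.Uᵀ * D.U) := by
        rw [hX.symm.trans D.eq_mul]; simp only [Matrix.mul_assoc]
    _ = _ := by rw [D.orthonormal_U, Matrix.one_mul, Matrix.mul_one]

theorem xi_eq_factorDerivative (hr : r ≤ p) (hX : X = Y * Yᵀ) (hY : Y.rank = r)
    (A : Matrix (Fin p) (Fin r) ℝ) :
    D.xi Y A = factorDerivative Y A := by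
  have hI := D.mul_transpose_add_mul_transpose hr
  have hUP := D.U_mul_P hX hY
  have hPU : (D.P Y)ᵀ * D.Uᵀ = Yᵀ := by rw [← Matrix.transpose_mul, hUP]
  have hA : D.U * (D.Uᵀ * (A * Yᵀ)) + D.Uperp * (D.Uperpᵀ * (A * Yᵀ)) = A * Yᵀ := by
    rw [← Matrix.mul_assoc D.U, ← Matrix.mul_assoc D.Uperp, ← Matrix.add_mul, hI, Matrix.one_mul]
  have hA' : Y * (Aᵀ * (D.U * D.Uᵀ)) + Y * (Aᵀ * (D.Uperp * D.Uperpᵀ)) = Y * Aᵀ := by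
    rw [← Matrix.mul_add, ← Matrix.mul_add, hI, Matrix.mul_one]
  rw [factorDerivative_apply, ← hA, ← hA', EigDecomp.xi, Matrix.fromCols_mul_fromBlocks,
    Matrix.transpose_fromCols, Matrix.fromCols_mul_fromRows]
  simp only [Matrix.mul_add, Matrix.add_mul, Matrix.mul_zero, add_zero, Matrix.mul_assoc, hPU]
  simp only [← Matrix.mul_assoc D.U (D.P Y), hUP]
  abel

theorem nullSpace_eq_ker (hX : X = Y * Yᵀ) (hY : Y.rank = r) :
    D.nullSpace Y = LinearMap.ker (factorDerivative Y) := by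
  have hP := D.isUnit_det_P hX hY
  have hPt : (D.P Y)ᵀ * ((D.P Y)⁻¹)ᵀ = 1 := by
    rw [← Matrix.transpose_mul, Matrix.nonsing_inv_mul _ hP, Matrix.transpose_one]
  have hUP := D.U_mul_P hX hY
  ext A
  rw [mem_ker_factorDerivative hY]
  constructor
  · rintro ⟨S, hS, rfl⟩
    refine ⟨(D.P Y)⁻¹ * S * ((D.P Y)⁻¹)ᵀ, ?_, ?_⟩
    · rw [mem_skewMatrices, Matrix.transpose_mul, Matrix.transpose_mul, Matrix.transpose_transpose,
        ← Matrix.mul_assoc, ← Matrix.add_mul, ← Matrix.mul_add, hS, Matrix.mul_zero,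
        Matrix.zero_mul]
    · have hU : D.U = Y * (D.P Y)⁻¹ := by
        calc D.U = D.U * (D.P Y * (D.P Y)⁻¹) := by
              rw [Matrix.mul_nonsing_inv _ hP, Matrix.mul_one]
          _ = _ := by rw [← Matrix.mul_assoc, hUP]
      rw [hU]
      simp only [Matrix.mul_assoc]
  · rintro ⟨T, hT, rfl⟩
    refine ⟨D.P Y * T * (D.P Y)ᵀ, ?_, ?_⟩
    · rw [Matrix.transpose_mul, Matrix.transpose_mul, Matrix.transpose_transpose,
        ← Matrix.mul_assoc, ← Matrix.add_mul, ← Matrix.mul_add, mem_skewMatrices.1 hT,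
        Matrix.mul_zero, Matrix.zero_mul]
    · rw [Matrix.mul_assoc, Matrix.mul_assoc (D.P Y * T), hPt, Matrix.mul_one, ← Matrix.mul_assoc,
        hUP]

theorem nonNullSpace_eq_orthogonal (hr : r ≤ p) (hX : X = Y * Yᵀ) (hY : Y.rank = r) :
    D.nonNullSpace Y = (LinearMap.ker (factorDerivative Y))ᗮ := by
  have hP := D.isUnit_det_P hX hY
  have hPt : (D.P Y)ᵀ * ((D.P Y)⁻¹)ᵀ = 1 := by
    rw [← Matrix.transpose_mul, Matrix.nonsing_inv_mul _ hP, Matrix.transpose_one]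
  have hUP := D.U_mul_P hX hY
  have hPU : Yᵀ = (D.P Y)ᵀ * D.Uᵀ := by rw [← Matrix.transpose_mul, hUP]
  have hd : (Matrix.diagonal D.d)⁻¹ = ((D.P Y)⁻¹)ᵀ * (D.P Y)⁻¹ := by
    rw [← D.P_mul_transpose hX, Matrix.mul_inv_rev, Matrix.transpose_nonsing_inv]
  ext A
  rw [mem_ker_factorDerivative_orthogonal hY]
  constructor
  · rintro ⟨S, C, hS, rfl⟩
    have hSP : S = S * (Matrix.diagonal D.d)⁻¹ * (D.P Y * (D.P Y)ᵀ) := by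
      rw [hd]
      calc S = S * (((D.P Y)⁻¹)ᵀ * ((D.P Y)⁻¹ * D.P Y) * (D.P Y)ᵀ) := by
            rw [Matrix.nonsing_inv_mul _ hP, Matrix.mul_one, ← Matrix.transpose_mul,
              Matrix.mul_nonsing_inv _ hP, Matrix.transpose_one, Matrix.mul_one]
        _ = _ := by simp only [Matrix.mul_assoc]
    have h1 : Yᵀ * ((D.U * S + D.Uperp * C) * ((D.P Y)⁻¹)ᵀ) =
        (D.P Y)ᵀ * (S * (Matrix.diagonal D.d)⁻¹) * D.P Y := by
      calc Yᵀ * ((D.U * S + D.Uperp * C) * ((D.P Y)⁻¹)ᵀ)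
          = (D.P Y)ᵀ * ((D.Uᵀ * D.U) * S + (D.Uᵀ * D.Uperp) * C) * ((D.P Y)⁻¹)ᵀ := by
            rw [hPU]; simp only [Matrix.mul_add, Matrix.add_mul, Matrix.mul_assoc]
        _ = (D.P Y)ᵀ * S * ((D.P Y)⁻¹)ᵀ := by
            rw [D.orthonormal_U, D.orthogonal, Matrix.one_mul, Matrix.zero_mul, add_zero]
        _ = (D.P Y)ᵀ * (S * (Matrix.diagonal D.d)⁻¹) * D.P Y * ((D.P Y)ᵀ * ((D.P Y)⁻¹)ᵀ) := by
            conv_lhs => rw [hSP]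
            simp only [Matrix.mul_assoc]
        _ = _ := by rw [hPt, Matrix.mul_one]
    rw [h1]
    rw [Matrix.transpose_mul, Matrix.transpose_mul, Matrix.transpose_transpose, hS.eq,
      ← Matrix.mul_assoc]
  · intro hA
    refine ⟨D.Uᵀ * A * (D.P Y)ᵀ, D.Uperpᵀ * A * (D.P Y)ᵀ, ?_, ?_⟩
    · have h1 : D.Uᵀ * A * (D.P Y)ᵀ * (Matrix.diagonal D.d)⁻¹ =
          ((D.P Y)⁻¹)ᵀ * (Yᵀ * A) * (D.P Y)⁻¹ := by
        calc _ = D.Uᵀ * A * ((D.P Y)ᵀ * ((D.P Y)⁻¹)ᵀ) * (D.P Y)⁻¹ := by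
              rw [hd]; simp only [Matrix.mul_assoc]
          _ = (((D.P Y)⁻¹)ᵀ * (D.P Y)ᵀ) * D.Uᵀ * A * (D.P Y)⁻¹ := by
              rw [hPt, ← Matrix.transpose_mul, Matrix.mul_nonsing_inv _ hP, Matrix.transpose_one,
                Matrix.one_mul, Matrix.mul_one]
          _ = _ := by rw [hPU]; simp only [Matrix.mul_assoc]
      rw [Matrix.IsSymm, h1, Matrix.transpose_mul, Matrix.transpose_mul, Matrix.transpose_transpose,
        hA, ← Matrix.mul_assoc]
    · calc A = (D.U * D.Uᵀ + D.Uperp * D.Uperpᵀ) * A * ((D.P Y)ᵀ * ((D.P Y)⁻¹)ᵀ) := by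
            rw [D.mul_transpose_add_mul_transpose hr, hPt, Matrix.one_mul, Matrix.mul_one]
        _ = _ := by simp only [Matrix.add_mul, Matrix.mul_assoc]

end EigDecomp

/-! ### The two Hessians at a stationary point -/

section Stationary

variable {p r : ℕ} {f : Matrix (Fin p) (Fin p) ℝ → ℝ} {Y : Matrix (Fin p) (Fin r) ℝ}

theorem ker_factorDerivative_le_ker_euclideanHessian (hf : ContDiff ℝ 2 f)
    (hfsymm : ∀ Z, f Z = f Zᵀ) (hY : Y.rank = r) (hg0 : gradient (factorized r f) Y = 0) :
    LinearMap.ker (factorDerivative Y) ≤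
      LinearMap.ker (euclideanHessian (factorized r f) Y).toLinearMap := by
  intro A hA
  obtain ⟨V, -, hV, hH⟩ := euclideanHessian_apply hf hfsymm hY hg0 A
  rw [LinearMap.mem_ker.1 hA, map_zero] at hV
  rw [LinearMap.mem_ker, ContinuousLinearMap.coe_coe, hH, hV, Matrix.zero_mul, smul_zero]

theorem isSymmetric_riemannianHess (hf : ContDiff ℝ 2 f)
    (hfsymm : ∀ Z, f Z = f Zᵀ) (hY : Y.rank = r) (hg0 : gradient (factorized r f) Y = 0) :
    (riemannianHess (psdManifold p r) f (Y * Yᵀ)).toLinearMap.IsSymmetric := by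
  have hg : ContDiff ℝ 2 (factorized r f) := hf.comp ContDiff.matrix_mul_transpose
  rintro ⟨ξ, hξ⟩ ⟨η, hη⟩
  obtain ⟨A, rfl⟩ : ξ ∈ LinearMap.range (factorDerivative Y) := by rwa [range_factorDerivative hY]
  obtain ⟨B, rfl⟩ : η ∈ LinearMap.range (factorDerivative Y) := by rwa [range_factorDerivative hY]
  have h1 := inner_euclideanHessian_eq_riemannianHess hf hfsymm hY hg0 A B
  have h2 := inner_euclideanHessian_eq_riemannianHess hf hfsymm hY hg0 B A
  exact h1.symm.trans ((inner_euclideanHessian_comm hg Y A B).trans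
    ((real_inner_comm _ _).trans (h2.trans (real_inner_comm _ _))))

end Stationary

end MatrixManifold

theorem mainTheorem1 {p r : ℕ} (hr : 0 < r)
    (f : Matrix (Fin p) (Fin p) ℝ → ℝ) (hf : ContDiff ℝ 2 f) (hfsymm : ∀ Z, f Z = f Zᵀ)
    (Y : Matrix (Fin p) (Fin r) ℝ) (hY : Y.rank = r)
    (X : Matrix (Fin p) (Fin p) ℝ) (hX : X = Y * Yᵀ)
    (g : Matrix (Fin p) (Fin r) ℝ → ℝ) (hg : g = factorized r f) :
    -- the two gradient identities
    (riemannianGrad (psdManifold p r) f X : Matrix (Fin p) (Fin p) ℝ) =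
        (1 / 2 : ℝ) • (gradient g Y * moorePenrose Y +
          (gradient g Y * moorePenrose Y)ᵀ * (1 - Y * moorePenrose Y)) ∧
    gradient g Y =
        (2 : ℝ) • ((riemannianGrad (psdManifold p r) f X : Matrix (Fin p) (Fin p) ℝ) * Y) ∧
    -- the Hessians at a Euclidean first-order stationary point
    (gradient g Y = 0 →
      -- the gradient field on the manifold is differentiable, so the Hessian is meaningful
      RiemannianGradDifferentiableAt (psdManifold p r) f X ∧
      (∀ D : EigDecomp X r,
        (∀ A : Matrix (Fin p) (Fin r) ℝ,
          ∃ hξ : D.xi Y A ∈ tangentSpaceAt (psdManifold p r) X,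
            inner ℝ (euclideanHessian g Y A) A =
              inner ℝ (riemannianHess (psdManifold p r) f X ⟨D.xi Y A, hξ⟩) ⟨D.xi Y A, hξ⟩) ∧
        -- the bijective linear map `A ↦ ξ_Y^A` from the complementary space to the tangent space
        (∃ L : D.nonNullSpace Y ≃ₗ[ℝ] tangentSpaceAt (psdManifold p r) X,
          (∀ A : D.nonNullSpace Y, (L A : Matrix (Fin p) (Fin p) ℝ) = D.xi Y A) ∧
          (∀ ξ : tangentSpaceAt (psdManifold p r) X,
            inner ℝ (riemannianHess (psdManifold p r) f X ξ) ξ =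
              inner ℝ (euclideanHessian g Y (L.symm ξ)) (L.symm ξ : Matrix (Fin p) (Fin r) ℝ)) ∧
          (∀ A : D.nonNullSpace Y,
            inner ℝ (euclideanHessian g Y A) (A : Matrix (Fin p) (Fin r) ℝ) =
              inner ℝ (riemannianHess (psdManifold p r) f X (L A)) (L A))) ∧
        -- the null space
        Module.finrank ℝ (D.nullSpace Y) = (r ^ 2 - r) / 2 ∧
        (∀ A ∈ D.nullSpace Y, euclideanHessian g Y A = 0)) ∧
      -- the eigenvalues, in non-increasing order
      (∃ (hT : Module.finrank ℝ (tangentSpaceAt (psdManifold p r) X) = p * r - (r ^ 2 - r) / 2)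
        (hRsymm : (riemannianHess (psdManifold p r) f X :
          tangentSpaceAt (psdManifold p r) X →ₗ[ℝ] tangentSpaceAt (psdManifold p r) X).IsSymmetric)
        (hE : Module.finrank ℝ (Matrix (Fin p) (Fin r) ℝ) = p * r)
        (hEsymm : (euclideanHessian g Y :
          Matrix (Fin p) (Fin r) ℝ →ₗ[ℝ] Matrix (Fin p) (Fin r) ℝ).IsSymmetric)
        (lam : Fin (p * r - (r ^ 2 - r) / 2) → ℝ),
        Antitone lam ∧
        Multiset.map (hEsymm.eigenvalues hE) Finset.univ.val =
          Multiset.replicate ((r ^ 2 - r) / 2) 0 + Multiset.map lam Finset.univ.val ∧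
        ∀ i, lam i ∈ Set.uIcc (2 * sigma r X * hRsymm.eigenvalues hT i)
          (4 * sigma 1 X * hRsymm.eigenvalues hT i))) := by
  subst hX hg
  have hrp : r ≤ p := by
    have := Y.rank_le_height
    omega
  have hfd := hf.differentiable two_ne_zero
  refine ⟨riemannianGrad_mul_transpose hfd hfsymm hY,
    gradient_factorized_eq_riemannianGrad hfd hfsymm hY, fun hg0 => ?_⟩
  have hg : ContDiff ℝ 2 (factorized r f) := hf.comp ContDiff.matrix_mul_transpose
  have hker := ker_factorDerivative_le_ker_euclideanHessian hf hfsymm hY hg0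
  have hHess := inner_euclideanHessian_eq_riemannianHess hf hfsymm hY hg0
  set H := euclideanHessian (factorized r f) Y with hH
  refine ⟨riemannianGrad_differentiableAt hf hfsymm hY, fun D => ⟨fun A => ?_, ?_, ?_, ?_⟩, ?_⟩
  · have hξ := D.xi_eq_factorDerivative hrp rfl hY A
    simp only [hξ]
    exact ⟨factorDerivative_mem hY A, hHess A A⟩
  · rw [D.nonNullSpace_eq_orthogonal hrp rfl hY]
    refine ⟨horizontalEquiv hY, fun A => (D.xi_eq_factorDerivative hrp rfl hY A).symm,
      fun ξ => ?_, fun A => hHess A A⟩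
    obtain ⟨A, rfl⟩ := (horizontalEquiv hY).surjective ξ
    rw [LinearEquiv.symm_apply_apply]
    exact (hHess A A).symm
  · rw [D.nullSpace_eq_ker rfl hY]
    exact finrank_ker_factorDerivative hY
  · rw [D.nullSpace_eq_ker rfl hY]
    exact fun A hA => hker hA
  · have hT := finrank_tangentSpaceAt hY
    have hRsymm := isSymmetric_riemannianHess hf hfsymm hY hg0
    have hE : Module.finrank ℝ (Matrix (Fin p) (Fin r) ℝ) = p * r := by
      simp [Module.finrank_matrix]
    have hEsymm : H.toLinearMap.IsSymmetric := inner_euclideanHessian_comm hg Y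
    have hinv : ∀ A ∈ (LinearMap.ker (factorDerivative Y))ᗮ,
        H.toLinearMap A ∈ (LinearMap.ker (factorDerivative Y))ᗮ := by
      intro A hA B hB
      rw [← hEsymm, LinearMap.mem_ker.1 (hker hB), inner_zero_left]
    have hS := hEsymm.restrict_invariant hinv
    have hl := (horizontalEquiv hY).finrank_eq.trans hT
    refine ⟨hT, hRsymm, hE, hEsymm, hS.eigenvalues hl, hS.eigenvalues_antitone hl,
      hEsymm.eigenvalues_eq_replicate_zero_add hE _ hker (finrank_ker_factorDerivative hY) hS hl
        fun _ => rfl, fun i => ?_⟩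
    have hbound := fun A : (LinearMap.ker (factorDerivative Y))ᗮ =>
      norm_sq_factorDerivative_mem_Icc hY ((mem_ker_factorDerivative_orthogonal hY).1 A.2)
    exact hS.eigenvalues_mem_uIcc_of_congruence hRsymm hl hT (horizontalEquiv hY)
      (fun A => hHess A A) (fun A => (hbound A).1) (fun A => (hbound A).2) i
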